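/- Let $d\ge 2$, let $r>0$, and let $a_1,a_2,\dots$ be independent standard normal random vectors in $\mathbb{R}^d$. For $m\ge 1$ put $h=h(m,r)=\sqrt{2r\log m}$, and for unit vectors $x,y\in\mathbb{S}^{d-1}$ define the score $$S(x,y)=\frac1m\sum_{i=1}^m \mathbf 1_{[\langle a_i,x\rangle\ge h]}\,\mathbf 1_{[\langle a_i,y\rangle\ge h]} .$$ For $t\in[-1,1]$ let $\mu(t)=\mathbb{E}\,S(x,y)$ for unit vectors with $\langle x,y\rangle=t$ (this depends only on $t$, $m$, $r$). Fix $y\in\mathbb{S}^{d-1}$ and $\lambda\in(2r-1,1)$ with $\lambda>0$. A document $x\in\mathbb{S}^{d-1}$ is retrieved if $S(x,y)\ge\mu(\lambda)$. For $\epsilon>0$, a type I error is a document $x$ with $\langle x,y\rangle\le\lambda-\epsilon$ that is retrieved, and a type II error is a document $x$ with $\langle x,y\rangle\ge\lambda+\epsilon$ that is not retrieved. For $\eta>0$ set $$\epsilon=\epsilon(\lambda,m,\eta,r)=C(\lambda,r,m,\eta)\,m^{-\frac{\lambda-(2r-1)}{2(1+\lambda)}},\qquad C(\lambda,r,m,\eta)=\frac{\sqrt{2\pi}\,(1+\lambda)(1-\lambda^2)^{1/4}}{\sqrt{2r\log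 m}}\,\eta .$$ Then for every $\eta>0$ and every integer $n\ge1$, $$\lim_{m\to\infty}\ \sup_{|\mathcal X|=n}\frac{\mathbb{E}(\text{number of type I errors in }\mathcal X)+\mathbb{E}(\text{number of type II errors in }\mathcal X)}{n}=P(N(0,1)\ge\eta),$$ where the supremum is over all sets $\mathcal X\subset\mathbb{S}^{d-1}$ of exactly $n$ documents. Moreover, for every integer $n\ge2$, taking $\eta=2\sqrt{\log n}$, $$\lim_{m\to\infty}\ \sup_{|\mathcal X|=n}\frac{\mathbb{E}(\text{number of type I errors in }\mathcal X)+\mathbb{E}(\text{number of type II errors in }\mathcal X)}{n}\le\frac{1}{n^2\sqrt{8\pi\log n}} .$$ -/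

import Mathlib

open MeasureTheory ProbabilityTheory Filter Topology

namespace SparseMap

/-- The space `ℝ^d` with its Euclidean norm. -/
abbrev Vec (d : ℕ) : Type := EuclideanSpace ℝ (Fin d)

/-- The unit sphere `𝕊^{d-1}` of `ℝ^d`. -/
abbrev UnitSphere (d : ℕ) : Type := Metric.sphere (0 : Vec d) 1

/-- The threshold `h(m, r) = √(2 r log m)`. -/
noncomputable def threshold (m : ℕ) (r : ℝ) : ℝ := Real.sqrt (2 * r * Real.log m)

/-- The `{0,1}`-valued bit `1_{⟨b, x⟩ ≥ h}` of the sparse map, as a real number. -/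
noncomputable def bit {d : ℕ} (h : ℝ) (b x : Vec d) : ℝ :=
  if h ≤ inner ℝ b x then 1 else 0

/-- The score `S(x, y) = (1/m) ∑_{i=1}^m 1_{⟨b_i, x⟩ ≥ h} 1_{⟨b_i, y⟩ ≥ h}`,
with `h = h(m, r)`, computed from the first `m` measurement vectors. -/
noncomputable def score {d : ℕ} (m : ℕ) (r : ℝ) (b : ℕ → Vec d) (x y : Vec d) : ℝ :=
  (1 / (m : ℝ)) * ∑ i ∈ Finset.range m,
    bit (threshold m r) (b i) x * bit (threshold m r) (b i) y

/-- The expected score `μ(t)` of two unit vectors with inner product `t`: the probability that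
two standard normal variables `v`, `w` with covariance `t` are both at least `h(m, r)`. The pair is
realised as `v = g₀`, `w = t g₀ + √(1 - t²) g₁` with `g₀, g₁` independent standard normal.
`integral_score_eq_meanScore` below shows that this is `E S(x, y)` whenever `⟨x, y⟩ = t`. -/
noncomputable def meanScore (m : ℕ) (r t : ℝ) : ℝ :=
  (stdGaussian (Vec 2)).real
    {g | threshold m r ≤ g 0 ∧ threshold m r ≤ t * g 0 + Real.sqrt (1 - t ^ 2) * g 1}

/-- The document `x` is retrieved for the query `y`: `S(x, y) ≥ μ(lam)`. -/
def Retrieved {d : ℕ} (m : ℕ) (r lam : ℝ) (b : ℕ → Vec d) (y x : Vec d) : Prop :=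
  meanScore m r lam ≤ score m r b x y

/-- `x` is `ε`-relevant: `⟨x, y⟩ ≥ lam + ε`. -/
def EpsRelevant {d : ℕ} (lam ε : ℝ) (y x : Vec d) : Prop := lam + ε ≤ inner ℝ x y

/-- `x` is `ε`-irrelevant: `⟨x, y⟩ ≤ lam - ε`. -/
def EpsIrrelevant {d : ℕ} (lam ε : ℝ) (y x : Vec d) : Prop := inner ℝ x y ≤ lam - ε

open Classical in
/-- The number of type I errors: `ε`-irrelevant documents of the corpus that are retrieved. -/
noncomputable def numTypeI {d : ℕ} (m : ℕ) (r lam ε : ℝ) (b : ℕ → Vec d) (y : Vec d)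
    (X : Finset (UnitSphere d)) : ℕ :=
  (X.filter fun x => EpsIrrelevant lam ε y x ∧ Retrieved m r lam b y x).card

open Classical in
/-- The number of type II errors: `ε`-relevant documents of the corpus that are not retrieved. -/
noncomputable def numTypeII {d : ℕ} (m : ℕ) (r lam ε : ℝ) (b : ℕ → Vec d) (y : Vec d)
    (X : Finset (UnitSphere d)) : ℕ :=
  (X.filter fun x => EpsRelevant lam ε y x ∧ ¬ Retrieved m r lam b y x).card

/-- The constant `C(lam, r, m, η) = √(2π) (1 + lam) (1 - lam²)^{1/4} / √(2 r log m) · η`. -/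
noncomputable def epsConst (lam r : ℝ) (m : ℕ) (η : ℝ) : ℝ :=
  Real.sqrt (2 * Real.pi) * (1 + lam) * (1 - lam ^ 2) ^ (1 / 4 : ℝ)
    / Real.sqrt (2 * r * Real.log m) * η

/-- `ε = C(lam, r, m, η) · m^{-(lam - (2r - 1)) / (2 (1 + lam))}`. -/
noncomputable def eps (lam r : ℝ) (m : ℕ) (η : ℝ) : ℝ :=
  epsConst lam r m η * (m : ℝ) ^ (-((lam - (2 * r - 1)) / (2 * (1 + lam))))

/-- The worst case, over all corpora `X ⊂ 𝕊^{d-1}` with exactly `n` documents, of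
`(E (number of type I errors) + E (number of type II errors)) / n`, where `a 0, a 1, …` are the
random measurement vectors on the probability space `(Ω, P)`. Expectations of these nonnegative
counts are taken in `[0, ∞]`. -/
noncomputable def worstErrorRate {Ω : Type*} [MeasurableSpace Ω] (P : Measure Ω) {d : ℕ}
    (a : ℕ → Ω → Vec d) (m n : ℕ) (r lam ε : ℝ) (y : Vec d) : ENNReal :=
  ⨆ X : {X : Finset (UnitSphere d) // X.card = n},
    ((∫⁻ ω, (numTypeI m r lam ε (fun i => a i ω) y X.1 : ENNReal) ∂P)
      + (∫⁻ ω, (numTypeII m r lam ε (fun i => a i ω) y X.1 : ENNReal) ∂P)) / (n : ENNReal)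

/-! The expected score of `x`, `y` is `meanScore` at `⟨x, y⟩`. -/

lemma charFun_map_pair {d : ℕ} (u v : Vec d) (s : Vec 2) :
    charFun ((stdGaussian (Vec d)).map (fun g => (!₂[inner ℝ g u, inner ℝ g v] : Vec 2))) s
      = Complex.exp (-((‖s 0 • u + s 1 • v‖ ^ 2 : ℝ) : ℂ) / 2) := by
  have hm : Measurable (fun g : Vec d => (!₂[inner ℝ g u, inner ℝ g v] : Vec 2)) := by
    refine (Continuous.measurable ?_)
    fun_prop
  have h := charFun_stdGaussian (E := Vec d) (s 0 • u + s 1 • v)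
  rw [charFun_apply] at h ⊢
  rw [integral_map hm.aemeasurable (by fun_prop)]
  push_cast
  rw [← h]
  congr 1
  ext g
  congr 3
  simp [PiLp.inner_apply, Fin.sum_univ_two, inner_add_right, inner_smul_right]

lemma stdGaussian_real_eq_meanScore {d : ℕ} (m : ℕ) (r : ℝ) (x y : Vec d)
    (hx : ‖x‖ = 1) (hy : ‖y‖ = 1) :
    (stdGaussian (Vec d)).real
      {g | threshold m r ≤ inner ℝ g x ∧ threshold m r ≤ inner ℝ g y}
      = meanScore m r (inner ℝ x y) := by
  set t : ℝ := inner ℝ x y with ht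
  have ht1 : 0 ≤ 1 - t ^ 2 := by
    have := abs_real_inner_le_norm x y
    rw [hx, hy, ← ht] at this
    nlinarith [abs_le.mp (by simpa using this : |t| ≤ 1)]
  let u : Vec 2 := !₂[1, 0]
  let v : Vec 2 := !₂[t, Real.sqrt (1 - t ^ 2)]
  have key : (stdGaussian (Vec d)).map (fun g => (!₂[inner ℝ g y, inner ℝ g x] : Vec 2))
      = (stdGaussian (Vec 2)).map (fun g => (!₂[inner ℝ g u, inner ℝ g v] : Vec 2)) := by
    have hm1 : Measurable (fun g : Vec d => (!₂[inner ℝ g y, inner ℝ g x] : Vec 2)) :=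
      Continuous.measurable (by fun_prop)
    have hm2 : Measurable (fun g : Vec 2 => (!₂[inner ℝ g u, inner ℝ g v] : Vec 2)) :=
      Continuous.measurable (by fun_prop)
    have := Measure.isProbabilityMeasure_map (μ := stdGaussian (Vec d)) hm1.aemeasurable
    have := Measure.isProbabilityMeasure_map (μ := stdGaussian (Vec 2)) hm2.aemeasurable
    apply Measure.ext_of_charFun
    ext s
    rw [charFun_map_pair, charFun_map_pair]
    congr 4
    rw [norm_add_sq_real, norm_add_sq_real]
    have hu : ‖u‖ ^ 2 = 1 := by simp [u, EuclideanSpace.norm_sq_eq]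
    have hv : ‖v‖ ^ 2 = 1 := by
      simp [v, EuclideanSpace.norm_sq_eq, Real.sq_sqrt ht1]
    have huv : inner ℝ u v = t := by simp [u, v, PiLp.inner_apply, Fin.sum_univ_two]
    simp only [norm_smul, mul_pow, hu, hv, hx, hy, inner_smul_left, inner_smul_right, huv,
      real_inner_comm x y]
    simp [← ht]
  have hS : MeasurableSet {p : Vec 2 | threshold m r ≤ p 1 ∧ threshold m r ≤ p 0} := by
    apply MeasurableSet.inter
    · exact measurableSet_le measurable_const (g := fun p : Vec 2 => p 1) (by fun_prop)
    · exact measurableSet_le measurable_const (g := fun p : Vec 2 => p 0) (by fun_prop)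
  have h := congrArg
    (fun μ : Measure (Vec 2) => μ.real {p : Vec 2 | threshold m r ≤ p 1 ∧ threshold m r ≤ p 0}) key
  simp only at h
  rw [map_measureReal_apply (Continuous.measurable (by fun_prop)) hS,
    map_measureReal_apply (Continuous.measurable (by fun_prop)) hS] at h
  have e1 : (fun g : Vec d => (!₂[inner ℝ g y, inner ℝ g x] : Vec 2)) ⁻¹'
      {p : Vec 2 | threshold m r ≤ p 1 ∧ threshold m r ≤ p 0}
      = {g | threshold m r ≤ inner ℝ g x ∧ threshold m r ≤ inner ℝ g y} := by
    ext g
    simp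
  have e2 : (fun g : Vec 2 => (!₂[inner ℝ g u, inner ℝ g v] : Vec 2)) ⁻¹'
      {p : Vec 2 | threshold m r ≤ p 1 ∧ threshold m r ≤ p 0}
      = {g | threshold m r ≤ g 0 ∧ threshold m r ≤ t * g 0 + Real.sqrt (1 - t ^ 2) * g 1} := by
    ext g
    have h0 : (inner ℝ g u : ℝ) = g 0 := by simp [u, PiLp.inner_apply, Fin.sum_univ_two]
    have h1 : (inner ℝ g v : ℝ) = t * g 0 + Real.sqrt (1 - t ^ 2) * g 1 := by
      simp [v, PiLp.inner_apply, Fin.sum_univ_two]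
    simp [h0, h1, and_comm]
  rw [e1, e2] at h
  exact h

lemma measurableSet_pair {d : ℕ} (h : ℝ) (x y : Vec d) :
    MeasurableSet {g : Vec d | h ≤ inner ℝ g x ∧ h ≤ inner ℝ g y} := by
  apply MeasurableSet.inter
  · exact measurableSet_le measurable_const (g := fun g : Vec d => (inner ℝ g x : ℝ)) (by fun_prop)
  · exact measurableSet_le measurable_const (g := fun g : Vec d => (inner ℝ g y : ℝ)) (by fun_prop)

lemma bit_mul_bit {d : ℕ} (h : ℝ) (x y g : Vec d) :
    bit h g x * bit h g y
      = {g : Vec d | h ≤ inner ℝ g x ∧ h ≤ inner ℝ g y}.indicator (fun _ => (1 : ℝ)) g := by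
  by_cases h1 : h ≤ inner ℝ g x <;> by_cases h2 : h ≤ inner ℝ g y <;> simp [bit, h1, h2]

lemma integral_sum_indicator {Ω E : Type*} [MeasurableSpace Ω] [MeasurableSpace E] (P : Measure Ω)
    (ν : Measure E) [IsProbabilityMeasure ν] (a : ℕ → Ω → E) (ha : ∀ i, HasLaw (a i) ν P)
    {m : ℕ} (hm : 1 ≤ m) {S : Set E} (hS : MeasurableSet S) :
    ∫ ω, (1 / (m : ℝ)) * ∑ i ∈ Finset.range m, S.indicator (fun _ => (1 : ℝ)) (a i ω) ∂P
      = ν.real S := by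
  have hmeas : ∀ i, AEStronglyMeasurable (S.indicator (fun _ => (1 : ℝ))) (P.map (a i)) :=
    fun i => (measurable_const.indicator hS).aestronglyMeasurable
  have hval : ∀ i, ∫ ω, S.indicator (fun _ => (1 : ℝ)) (a i ω) ∂P = ν.real S := by
    intro i
    rw [← integral_map (ha i).aemeasurable (hmeas i), (ha i).map_eq,
      integral_indicator_const _ hS, smul_eq_mul, mul_one]
  have hint : ∀ i, Integrable (fun ω => S.indicator (fun _ => (1 : ℝ)) (a i ω)) P := by
    intro i
    have h : Integrable (S.indicator (fun _ => (1 : ℝ))) (P.map (a i)) := by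
      rw [(ha i).map_eq]
      exact (integrable_const _).indicator hS
    exact (integrable_map_measure (hmeas i) (ha i).aemeasurable).1 h
  have hm0 : (m : ℝ) ≠ 0 := Nat.cast_ne_zero.mpr (by omega)
  rw [integral_const_mul, integral_finsetSum _ (fun i _ => hint i)]
  simp only [hval, Finset.sum_const, Finset.card_range, nsmul_eq_mul]
  field_simp

/-- If the measurement vectors are standard normal, then `E S(x, y) = μ(⟨x, y⟩)`. -/
theorem integral_score_eq_meanScore {Ω : Type*} [MeasurableSpace Ω] (P : Measure Ω)
    {d : ℕ} (a : ℕ → Ω → Vec d)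
    (ha : ∀ i, HasLaw (a i) (stdGaussian (Vec d)) P) {m : ℕ} (hm : 1 ≤ m) (r : ℝ)
    (x y : Vec d) (hx : ‖x‖ = 1) (hy : ‖y‖ = 1) :
    ∫ ω, score m r (fun i => a i ω) x y ∂P = meanScore m r (inner ℝ x y) := by
  simp only [score, bit_mul_bit]
  rw [integral_sum_indicator P _ a ha hm (measurableSet_pair _ x y)]
  exact stdGaussian_real_eq_meanScore m r x y hx hy

end SparseMap

/-!
The number of hits `m S(x, y)` of a document with `⟨x, y⟩ = t` is binomial with parameters `m` and
`μ(t)`, where `μ(t) = P(v ≥ h, w ≥ h)` for standard normal `v`, `w` with correlation `t`. The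
theorem is therefore a statement about binomial tails above the level `m μ(lam)`.

*The success probability.* Integrating over the orthant in polar coordinates gives Craig's formula
`μ(t) = π⁻¹ ∫_{arccos t / 2}^{π/2} exp (-h² / (2 cos² θ)) dθ` (`meanScore_eq_orthantProb`). It shows
that `μ` is increasing and that `μ'(t) = exp (-h² / (1 + t)) / (2π √(1 - t²))`
(`hasDerivAt_orthantProb`). Comparing this derivative with that of `exp (-h² / (1 + t))`, by
Cauchy's mean value theorem, gives `μ(t) ∼ (1 + t)² / h² · μ'(t)` as `h → ∞`
(`tendsto_orthantProb_scaled`). As `exp (-h² / (1 + lam)) = m ^ (-2r / (1 + lam))`, the mean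
`m μ(lam)` tends to infinity exactly because `lam > 2r - 1`, and `ε` is chosen so that
`m (μ(lam) - μ(lam - ε)) ∼ m ε μ'(lam) ∼ η √(m μ(lam))`: the cut-off lies `η` standard deviations
above the mean of a document at `lam - ε`, and similarly below that of a document at `lam + ε`.

*The limit of one error probability.* A central limit theorem for binomial variables whose success
probability tends to `0` and whose mean tends to infinity (`tendsto_binomialTail`, proved with
characteristic functions and Lévy's theorem) shows that both error probabilities tend to
`P(N(0, 1) ≥ η)` (`tendsto_retrieval_tail`). The parameter `η` is allowed to vary with `m`, and may
be negative.

*The supremum.* Binomial tails increase with the success probability, by a coupling through uniform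
variables, so each document errs at most as often as one exactly `ε` away from `lam`; no document
can commit errors of both types (`worstErrorRate_le`). For the lower bound, `n` distinct documents
are placed at inner products in a short interval just below `lam - ε`, corresponding to parameters
between `η` and `η + 1 / (m + 1)`, which does not affect the limit (`le_worstErrorRate`). The
second claim is Mills' bound for the normal tail at `2 √(log n)`.
-/

namespace SparseMap

/-! ### Binomial tails: monotone coupling and central limit theorem -/

lemma charFun_sum_indicator {ι Ω E : Type*} [MeasurableSpace Ω] [MeasurableSpace E]
    (P : Measure Ω) [IsProbabilityMeasure P] (ν : Measure E) [IsProbabilityMeasure ν]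
    {X : ι → Ω → E} (hlaw : ∀ i, HasLaw (X i) ν P) (hind : iIndepFun X P)
    {S : Set E} (hS : MeasurableSet S) (s : Finset ι) (t : ℝ) :
    charFun (P.map fun ω => ∑ i ∈ s, S.indicator (fun _ => (1 : ℝ)) (X i ω)) t
      = (1 + (ν.real S : ℂ) * (Complex.exp (t * Complex.I) - 1)) ^ s.card := by
  have hf : Measurable (S.indicator (fun _ => (1 : ℝ))) := measurable_const.indicator hS
  have hY : iIndepFun (fun i ω => S.indicator (fun _ => (1 : ℝ)) (X i ω)) P :=
    hind.comp (fun _ => S.indicator (fun _ => (1 : ℝ))) (fun _ => hf)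
  have hm : ∀ i, AEMeasurable (fun ω => S.indicator (fun _ => (1 : ℝ)) (X i ω)) P :=
    fun i => hf.comp_aemeasurable (hlaw i).aemeasurable
  have hmap : ∀ i, P.map (fun ω => S.indicator (fun _ => (1 : ℝ)) (X i ω))
      = ν.map (S.indicator (fun _ => (1 : ℝ))) := by
    intro i
    rw [← (hlaw i).map_eq, AEMeasurable.map_map_of_aemeasurable hf.aemeasurable
      (hlaw i).aemeasurable]
    rfl
  have hone : charFun (ν.map (S.indicator (fun _ => (1 : ℝ)))) t
      = 1 + (ν.real S : ℂ) * (Complex.exp (t * Complex.I) - 1) := by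
    rw [charFun_apply_real, integral_map hf.aemeasurable (by fun_prop)]
    have : ∀ x, Complex.exp (t * (S.indicator (fun _ => (1 : ℝ)) x : ℝ) * Complex.I)
        = 1 + S.indicator (fun _ => Complex.exp (t * Complex.I) - 1) x := by
      intro x
      by_cases hx : x ∈ S <;> simp [hx]
    simp_rw [this]
    rw [integral_add (integrable_const _) ((integrable_const _).indicator hS),
      integral_indicator_const _ hS]
    simp
  rw [iIndepFun.charFun_map_fun_finsetSum_eq_prod (fun i _ => hm i) (hY.restrict s),
    Finset.prod_apply]
  simp only [hmap, hone, Finset.prod_const]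

/-- The probability that a binomial variable with parameters `m` and `p` is at least `c`. The
binomial variable is realised as the number of indices `i` with `u i ≤ p`, for `m` independent
uniform variables `u i` on `[0, 1]`, which couples all values of `p` monotonically. -/
noncomputable def binomialTail (m : ℕ) (p c : ℝ) : ENNReal :=
  (Measure.pi fun _ : Fin m => (volume : Measure unitInterval))
    {u | c ≤ ∑ i, {v : unitInterval | (v : ℝ) ≤ p}.indicator (fun _ => (1 : ℝ)) (u i)}

lemma binomialTail_mono (m : ℕ) {p q : ℝ} (hpq : p ≤ q) (c : ℝ) :
    binomialTail m p c ≤ binomialTail m q c := by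
  refine measure_mono fun u hu => ?_
  rw [Set.mem_ofPred_eq] at hu ⊢
  refine hu.trans (Finset.sum_le_sum fun i _ => ?_)
  exact Set.indicator_le_indicator_of_subset (fun v hv => le_trans hv hpq) (fun _ => zero_le_one) _

lemma measurableSet_subtype_le (p : ℝ) : MeasurableSet {v : unitInterval | (v : ℝ) ≤ p} :=
  measurableSet_le measurable_subtype_coe measurable_const

lemma volume_real_subtype_le {p : ℝ} (hp0 : 0 ≤ p) (hp1 : p ≤ 1) :
    (volume : Measure unitInterval).real {v : unitInterval | (v : ℝ) ≤ p} = p := by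
  have : {v : unitInterval | (v : ℝ) ≤ p} = Set.Iic ⟨p, hp0, hp1⟩ := rfl
  rw [this, measureReal_def, unitInterval.volume_Iic]
  simp [hp0]

lemma charFun_map_count_uniform (m : ℕ) {p : ℝ} (hp0 : 0 ≤ p) (hp1 : p ≤ 1) (t : ℝ) :
    charFun ((Measure.pi fun _ : Fin m => (volume : Measure unitInterval)).map fun u =>
      ∑ i, {v : unitInterval | (v : ℝ) ≤ p}.indicator (fun _ => (1 : ℝ)) (u i)) t
      = (1 + (p : ℂ) * (Complex.exp (t * Complex.I) - 1)) ^ m := by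
  have h := charFun_sum_indicator (Measure.pi fun _ : Fin m => (volume : Measure unitInterval))
    (volume : Measure unitInterval) (X := fun i u => u i)
    (fun i => ⟨(measurable_pi_apply i).aemeasurable, (measurePreserving_eval _ i).map_eq⟩)
    (iIndepFun_pi (X := fun _ u => u) (fun _ => aemeasurable_id)) (measurableSet_subtype_le p)
    Finset.univ t
  rw [volume_real_subtype_le hp0 hp1] at h
  simpa using h

/-- The number of successes among `m` independent trials has the law that defines
`binomialTail`. -/
lemma measure_le_sum_indicator {Ω E : Type*} [MeasurableSpace Ω] [MeasurableSpace E]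
    (P : Measure Ω) [IsProbabilityMeasure P] (ν : Measure E) [IsProbabilityMeasure ν]
    {X : ℕ → Ω → E} (hlaw : ∀ i, HasLaw (X i) ν P) (hind : iIndepFun X P)
    {S : Set E} (hS : MeasurableSet S) (m : ℕ) (c : ℝ) :
    P {ω | c ≤ ∑ i ∈ Finset.range m, S.indicator (fun _ => (1 : ℝ)) (X i ω)}
      = binomialTail m (ν.real S) c := by
  have hf : Measurable (S.indicator (fun _ => (1 : ℝ))) := measurable_const.indicator hS
  have hm1 : AEMeasurable (fun ω => ∑ i ∈ Finset.range m,
      S.indicator (fun _ => (1 : ℝ)) (X i ω)) P :=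
    Finset.aemeasurable_fun_sum _ fun i _ => hf.comp_aemeasurable (hlaw i).aemeasurable
  have hm2 : Measurable (fun u : Fin m → unitInterval => ∑ i,
      {v : unitInterval | (v : ℝ) ≤ ν.real S}.indicator (fun _ => (1 : ℝ)) (u i)) :=
    Finset.measurable_sum _ fun i _ =>
      (measurable_const.indicator (measurableSet_subtype_le _)).comp (measurable_pi_apply i)
  have hlaws : P.map (fun ω => ∑ i ∈ Finset.range m, S.indicator (fun _ => (1 : ℝ)) (X i ω))
      = (Measure.pi fun _ : Fin m => (volume : Measure unitInterval)).map fun u => ∑ i,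
        {v : unitInterval | (v : ℝ) ≤ ν.real S}.indicator (fun _ => (1 : ℝ)) (u i) := by
    have := Measure.isProbabilityMeasure_map hm1
    have := Measure.isProbabilityMeasure_map (hm2.aemeasurable
      (μ := Measure.pi fun _ : Fin m => (volume : Measure unitInterval)))
    apply Measure.ext_of_charFun
    ext t
    rw [charFun_map_count_uniform m measureReal_nonneg measureReal_le_one,
      charFun_sum_indicator P ν hlaw hind hS, Finset.card_range]
  have h := congrArg (fun μ : Measure ℝ => μ (Set.Ici c)) hlaws
  rw [Measure.map_apply_of_aemeasurable hm1 measurableSet_Ici,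
    Measure.map_apply hm2 measurableSet_Ici] at h
  exact h

/-- Second-order expansion of the characteristic function of a centred Bernoulli variable. -/
lemma norm_bernoulli_charFun_sub_le {p τ : ℝ} (hp0 : 0 ≤ p) (hp1 : p ≤ 1) (hτ : |τ| ≤ 1) :
    ‖Complex.exp (-(p * τ : ℝ) * Complex.I) * (1 + (p : ℂ) * (Complex.exp (τ * Complex.I) - 1))
      - 1 + ((p * (1 - p) * τ ^ 2 / 2 : ℝ) : ℂ)‖ ≤ 2 * p * |τ| ^ 3 := by
  have key : ∀ x : ℝ, |x| ≤ 1 →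
      ‖Complex.exp (x * Complex.I) - (1 + x * Complex.I - (x : ℂ) ^ 2 / 2)‖ ≤ |x| ^ 3 := by
    intro x hx
    have hn : ‖(x : ℂ) * Complex.I‖ = |x| := by simp
    have h := Complex.exp_bound (x := x * Complex.I) (by rw [hn]; exact hx) (n := 3) (by norm_num)
    rw [hn] at h
    have e : ∑ i ∈ Finset.range 3, ((x : ℂ) * Complex.I) ^ i / (i.factorial : ℂ)
        = 1 + x * Complex.I - (x : ℂ) ^ 2 / 2 := by
      simp [Finset.sum_range_succ, mul_pow, Nat.factorial]
      ring
    rw [e] at h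
    refine h.trans ?_
    have := pow_nonneg (abs_nonneg x) 3
    norm_num [Nat.factorial]
    nlinarith
  have h1 : |-(p * τ)| ≤ 1 := by
    rw [abs_neg, abs_mul, abs_of_nonneg hp0]
    nlinarith [abs_nonneg τ]
  have h2 : |(1 - p) * τ| ≤ 1 := by
    rw [abs_mul, abs_of_nonneg (by linarith : 0 ≤ 1 - p)]
    nlinarith [abs_nonneg τ]
  have k1 := key _ h1
  have k2 := key _ h2
  have e : Complex.exp (-(p * τ : ℝ) * Complex.I)
        * (1 + (p : ℂ) * (Complex.exp (τ * Complex.I) - 1)) - 1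
        + ((p * (1 - p) * τ ^ 2 / 2 : ℝ) : ℂ)
      = ((1 - p : ℝ) : ℂ) * (Complex.exp ((-(p * τ) : ℝ) * Complex.I)
          - (1 + (-(p * τ) : ℝ) * Complex.I - ((-(p * τ) : ℝ) : ℂ) ^ 2 / 2))
        + (p : ℂ) * (Complex.exp (((1 - p) * τ : ℝ) * Complex.I)
          - (1 + ((1 - p) * τ : ℝ) * Complex.I - (((1 - p) * τ : ℝ) : ℂ) ^ 2 / 2)) := by
    have : Complex.exp (((1 - p) * τ : ℝ) * Complex.I)
        = Complex.exp ((-(p * τ) : ℝ) * Complex.I) * Complex.exp (τ * Complex.I) := by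
      rw [← Complex.exp_add]
      congr 1
      push_cast
      ring
    rw [this]
    push_cast
    ring
  rw [e]
  refine (norm_add_le _ _).trans ?_
  rw [norm_mul, norm_mul, Complex.norm_real, Complex.norm_real, Real.norm_eq_abs, Real.norm_eq_abs,
    abs_of_nonneg hp0, abs_of_nonneg (by linarith : 0 ≤ 1 - p)]
  have b1 : |-(p * τ)| ^ 3 ≤ p * |τ| ^ 3 := by
    rw [abs_neg, abs_mul, abs_of_nonneg hp0, mul_pow]
    have : p ^ 3 ≤ p := pow_le_of_le_one hp0 hp1 (by norm_num)
    gcongr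
  have b2 : |(1 - p) * τ| ^ 3 ≤ |τ| ^ 3 := by
    rw [abs_mul, abs_of_nonneg (by linarith : 0 ≤ 1 - p)]
    gcongr
    nlinarith [abs_nonneg τ]
  have := pow_nonneg (abs_nonneg τ) 3
  calc _ ≤ 1 * (p * |τ| ^ 3) + p * |τ| ^ 3 := by
        gcongr
        · linarith
        · exact k1.trans b1
        · exact k2.trans b2
    _ = 2 * p * |τ| ^ 3 := by ring

/-- Pointwise convergence of the characteristic functions of centred and scaled binomial variables
with success probabilities tending to `0`. -/
lemma tendsto_binomial_charFun {p s : ℕ → ℝ} (hp0 : ∀ m, 0 ≤ p m) (hp1 : ∀ m, p m ≤ 1)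
    (hp : Tendsto p atTop (𝓝 0)) (hs : Tendsto s atTop atTop)
    (hps : Tendsto (fun m : ℕ => m * p m / s m ^ 2) atTop (𝓝 1)) (t : ℝ) :
    Tendsto (fun m : ℕ => (Complex.exp (-(p m * (t / s m) : ℝ) * Complex.I)
      * (1 + (p m : ℂ) * (Complex.exp ((t / s m : ℝ) * Complex.I) - 1))) ^ m) atTop
      (𝓝 (Complex.exp (-(t : ℂ) ^ 2 / 2))) := by
  set f : ℕ → ℂ := fun m => Complex.exp (-(p m * (t / s m) : ℝ) * Complex.I)
      * (1 + (p m : ℂ) * (Complex.exp ((t / s m : ℝ) * Complex.I) - 1)) with hf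
  have hτ : Tendsto (fun m => t / s m) atTop (𝓝 0) := hs.const_div_atTop t
  have hmain : Tendsto (fun m : ℕ => -((m * (p m * (1 - p m) * (t / s m) ^ 2 / 2) : ℝ) : ℂ)) atTop
      (𝓝 (-(t : ℂ) ^ 2 / 2)) := by
    have : Tendsto (fun m : ℕ => -(m * p m / s m ^ 2 * (1 - p m) * (t ^ 2 / 2))) atTop
        (𝓝 (-(1 * (1 - 0) * (t ^ 2 / 2)))) :=
      ((hps.mul (hp.const_sub 1)).mul_const _).neg
    have h := (Complex.continuous_ofReal.tendsto _).comp this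
    have e : ((-(1 * (1 - 0) * (t ^ 2 / 2)) : ℝ) : ℂ) = -(t : ℂ) ^ 2 / 2 := by
      push_cast
      ring
    rw [e] at h
    refine h.congr fun m => ?_
    simp only [Function.comp]
    push_cast
    ring
  have hrem : Tendsto (fun m : ℕ => (m : ℂ) * (f m - 1)
      - -((m * (p m * (1 - p m) * (t / s m) ^ 2 / 2) : ℝ) : ℂ)) atTop (𝓝 0) := by
    have hb : Tendsto (fun m : ℕ => 2 * (m * p m / s m ^ 2) * t ^ 2 * |t / s m|) atTop (𝓝 0) := by
      have := ((hps.const_mul 2).mul_const (t ^ 2)).mul hτ.abs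
      simpa using this
    refine squeeze_zero_norm' ?_ hb
    filter_upwards [hτ.abs.eventually_le_const (show |(0 : ℝ)| < 1 by simp)] with m hm
    have h := norm_bernoulli_charFun_sub_le (hp0 m) (hp1 m) hm
    have e : (m : ℂ) * (f m - 1) - -((m * (p m * (1 - p m) * (t / s m) ^ 2 / 2) : ℝ) : ℂ)
        = (m : ℂ) * (f m - 1 + ((p m * (1 - p m) * (t / s m) ^ 2 / 2 : ℝ) : ℂ)) := by
      push_cast
      ring
    rw [e, norm_mul, Complex.norm_natCast]
    calc (m : ℝ) * _ ≤ m * (2 * p m * |t / s m| ^ 3) := by gcongr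
      _ = 2 * (m * p m / s m ^ 2) * t ^ 2 * |t / s m| := by
        rw [pow_succ, sq_abs]
        ring
  have hlim := hrem.add hmain
  rw [zero_add] at hlim
  have := Complex.tendsto_one_add_pow_exp_of_tendsto (g := fun m => f m - 1)
    (hlim.congr fun m => by ring)
  refine this.congr fun m => ?_
  rw [add_sub_cancel]

/-- Central limit theorem for binomial tails with varying success probabilities `p m → 0`. The
scale `s m` is asymptotic to the standard deviation, and `c m` lies about `η` standard deviations
above the mean. -/
lemma tendsto_binomialTail {p s c : ℕ → ℝ} {η : ℝ} (hp0 : ∀ m, 0 ≤ p m) (hp1 : ∀ m, p m ≤ 1)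
    (hp : Tendsto p atTop (𝓝 0)) (hs : Tendsto s atTop atTop)
    (hps : Tendsto (fun m : ℕ => m * p m / s m ^ 2) atTop (𝓝 1))
    (hc : Tendsto (fun m : ℕ => (c m - m * p m) / s m) atTop (𝓝 η)) :
    Tendsto (fun m => binomialTail m (p m) (c m)) atTop (𝓝 (gaussianReal 0 1 (Set.Ici η))) := by
  let N : (m : ℕ) → (Fin m → unitInterval) → ℝ := fun m u =>
    ∑ i, {v : unitInterval | (v : ℝ) ≤ p m}.indicator (fun _ => (1 : ℝ)) (u i)
  have hN : ∀ m, Measurable (N m) := fun m => Finset.measurable_sum _ fun i _ =>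
    (measurable_const.indicator (measurableSet_subtype_le _)).comp (measurable_pi_apply i)
  let Q : (m : ℕ) → Measure (Fin m → unitInterval) := fun m => Measure.pi fun _ => volume
  have hW : ∀ m, Measurable (fun u => (s m)⁻¹ * (N m u) + (-(c m / s m))) := fun m =>
    ((hN m).const_mul _).add_const _
  let L : ℕ → ProbabilityMeasure ℝ := fun m =>
    ⟨(Q m).map (fun u => (s m)⁻¹ * (N m u) + (-(c m / s m))),
      Measure.isProbabilityMeasure_map (hW m).aemeasurable⟩
  let G : ProbabilityMeasure ℝ := ⟨gaussianReal (-η) 1, inferInstance⟩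
  have hL : Tendsto L atTop (𝓝 G) := by
    refine ProbabilityMeasure.tendsto_iff_tendsto_charFun.2 fun t => ?_
    have hchar : ∀ m, charFun (L m : Measure ℝ) t
        = Complex.exp (-((t * ((c m - m * p m) / s m) : ℝ) : ℂ) * Complex.I)
          * (Complex.exp (-(p m * (t / s m) : ℝ) * Complex.I)
      * (1 + (p m : ℂ) * (Complex.exp ((t / s m : ℝ) * Complex.I) - 1))) ^ m := by
      intro m
      have e1 : (L m : Measure ℝ)
          = (((Q m).map (N m)).map ((s m)⁻¹ * ·)).map (· + (-(c m / s m))) := by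
        rw [Measure.map_map (by fun_prop) (hN m), Measure.map_map (by fun_prop) (by
          exact (hN m).const_mul _)]
        rfl
      rw [e1, charFun_map_add_const, charFun_map_mul,
        charFun_map_count_uniform m (hp0 m) (hp1 m), mul_pow, ← Complex.exp_nat_mul, mul_comm,
        ← mul_assoc, ← Complex.exp_add]
      have e2 : ((s m)⁻¹ * t) = t / s m := by ring
      rw [e2]
      congr 2
      simp
      ring
    simp_rw [hchar]
    have h1 : Tendsto (fun m : ℕ => Complex.exp (-((t * ((c m - m * p m) / s m) : ℝ) : ℂ)
        * Complex.I)) atTop (𝓝 (Complex.exp (-((t * η : ℝ) : ℂ) * Complex.I))) := by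
      refine (Complex.continuous_exp.tendsto _).comp (Tendsto.mul_const _ (Tendsto.neg ?_))
      exact (Complex.continuous_ofReal.tendsto _).comp (hc.const_mul t)
    have h2 := h1.mul (tendsto_binomial_charFun hp0 hp1 hp hs hps t)
    have e3 : charFun (G : Measure ℝ) t = Complex.exp (-((t * η : ℝ) : ℂ) * Complex.I)
        * Complex.exp (-(t : ℂ) ^ 2 / 2) := by
      change charFun (gaussianReal (-η) 1) t = _
      rw [charFun_gaussianReal, ← Complex.exp_add]
      congr 1
      push_cast
      ring
    rw [e3]
    exact h2
  have hfr : (G : Measure ℝ) (frontier (Set.Ici 0)) = 0 := by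
    have := nullSingletonClass_gaussianReal (μ := -η) (v := 1) one_ne_zero
    rw [frontier_Ici]
    exact measure_singleton (μ := gaussianReal (-η) 1) _
  have hlim := ProbabilityMeasure.tendsto_measure_of_null_frontier_of_tendsto' hL hfr
  have hG : (G : Measure ℝ) (Set.Ici 0) = gaussianReal 0 1 (Set.Ici η) := by
    have h := gaussianReal_map_add_const (μ := 0) (v := 1) (-η)
    rw [zero_add] at h
    change gaussianReal (-η) 1 (Set.Ici 0) = _
    rw [← h, Measure.map_apply (by fun_prop) measurableSet_Ici]
    congr 1
    ext x
    simp
  rw [← hG]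
  refine hlim.congr' ?_
  filter_upwards [hs.eventually_gt_atTop 0] with m hm
  change (Q m).map _ _ = _
  rw [Measure.map_apply (hW m) measurableSet_Ici]
  change _ = Q m {u | c m ≤ N m u}
  congr 1
  ext u
  simp only [Set.mem_preimage, Set.mem_Ici, Set.mem_ofPred_eq]
  rw [← sub_eq_add_neg, sub_nonneg, inv_mul_eq_div, div_le_div_iff_of_pos_right hm]

/-! ### The bivariate normal orthant probability -/

lemma lintegral_Ici_mul_exp_neg_sq {a : ℝ} (ha : 0 ≤ a) :
    ∫⁻ ρ in Set.Ici a, ENNReal.ofReal (ρ * Real.exp (-ρ ^ 2 / 2))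
      = ENNReal.ofReal (Real.exp (-a ^ 2 / 2)) := by
  have hd : ∀ x ∈ Set.Ici a, HasDerivAt (fun ρ : ℝ => -Real.exp (-ρ ^ 2 / 2))
      (x * Real.exp (-x ^ 2 / 2)) x := by
    intro x _
    have h := (((hasDerivAt_pow 2 x).neg.div_const 2).exp).neg
    convert! h using 1
    simp
    ring
  have hnn : ∀ x ∈ Set.Ioi a, 0 ≤ x * Real.exp (-x ^ 2 / 2) := fun x hx =>
    mul_nonneg (ha.trans (le_of_lt hx)) (Real.exp_pos _).le
  have hlim : Tendsto (fun ρ : ℝ => -Real.exp (-ρ ^ 2 / 2)) atTop (𝓝 0) := by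
    have h : Tendsto (fun ρ : ℝ => -ρ ^ 2 / 2) atTop atBot := by
      have := (tendsto_pow_atTop (α := ℝ) two_ne_zero).atTop_div_const (two_pos (α := ℝ))
      refine (tendsto_neg_atTop_atBot.comp this).congr fun x => ?_
      simp [neg_div]
    simpa using (Real.tendsto_exp_atBot.comp h).neg
  have hi := integrableOn_Ioi_deriv_of_nonneg' hd hnn hlim
  have hv := integral_Ioi_of_hasDerivAt_of_nonneg' hd hnn hlim
  rw [setLIntegral_congr Ioi_ae_eq_Ici.symm, ← ofReal_integral_eq_lintegral_ofReal hi
    ((ae_restrict_iff' measurableSet_Ioi).2 (Eventually.of_forall hnn)), hv]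
  simp

/-- The standard Gaussian measure of a planar set as an integral in Cartesian coordinates. -/
lemma stdGaussian_two_apply {A : Set (Vec 2)} (hA : MeasurableSet A) :
    stdGaussian (Vec 2) A = ∫⁻ p : ℝ × ℝ, A.indicator (fun _ => 1) (!₂[p.1, p.2] : Vec 2)
      * ENNReal.ofReal (1 / (2 * Real.pi) * Real.exp (-(p.1 ^ 2 + p.2 ^ 2) / 2)) := by
  have hT : Measurable (fun p : ℝ × ℝ => (!₂[p.1, p.2] : Vec 2)) :=
    Continuous.measurable (by fun_prop)
  have hmap : stdGaussian (Vec 2)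
      = ((gaussianReal 0 1).prod (gaussianReal 0 1)).map (fun p => (!₂[p.1, p.2] : Vec 2)) := by
    have h := (measurePreserving_finTwoArrow (gaussianReal 0 1)).symm.map_eq
    rw [← map_pi_eq_stdGaussian, ← h, Measure.map_map (by fun_prop) (MeasurableEquiv.measurable _)]
    rfl
  have hpdf : (gaussianReal 0 1).prod (gaussianReal 0 1)
      = (volume : Measure (ℝ × ℝ)).withDensity
        (fun p => gaussianPDF 0 1 p.1 * gaussianPDF 0 1 p.2) := by
    rw [gaussianReal_of_var_ne_zero _ one_ne_zero,
      prod_withDensity (measurable_gaussianPDF _ _) (measurable_gaussianPDF _ _)]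
    rfl
  rw [hmap, Measure.map_apply hT hA, hpdf, withDensity_apply _ (hT hA),
    ← lintegral_indicator (hT hA)]
  refine lintegral_congr fun p => ?_
  have e : gaussianPDF 0 1 p.1 * gaussianPDF 0 1 p.2
      = ENNReal.ofReal (1 / (2 * Real.pi) * Real.exp (-(p.1 ^ 2 + p.2 ^ 2) / 2)) := by
    rw [gaussianPDF, gaussianPDF, ← ENNReal.ofReal_mul (gaussianPDFReal_nonneg _ _ _)]
    congr 1
    simp only [gaussianPDFReal, NNReal.coe_one, mul_one, sub_zero]
    have h2 : Real.sqrt (2 * Real.pi) * Real.sqrt (2 * Real.pi) = 2 * Real.pi :=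
      Real.mul_self_sqrt (by positivity)
    rw [mul_mul_mul_comm, ← Real.exp_add, ← mul_inv, h2, one_div]
    congr 2
    ring
  by_cases hp : (!₂[p.1, p.2] : Vec 2) ∈ A
  · rw [Set.indicator_of_mem (by exact hp), Set.indicator_of_mem hp, one_mul, e]
  · rw [Set.indicator_of_notMem (by exact hp), Set.indicator_of_notMem hp, zero_mul]

/-- Craig's formula for the bivariate normal orthant probability `P(v ≥ h, w ≥ h)` of a pair with
correlation `t`; `meanScore_eq_orthantProb` shows that this integral is that probability. At the
upper limit `θ = π / 2` the integrand takes the junk value `exp 0`, on a null set. -/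
noncomputable def orthantProb (h t : ℝ) : ℝ :=
  (1 / Real.pi) * ∫ θ in (Real.arccos t / 2)..(Real.pi / 2),
    Real.exp (-(h ^ 2 / 2) / Real.cos θ ^ 2)

/-- For `h > 0` and a ray at angle `θ`, the wedge with half-opening determined by `β` is entered
at distance `h / cos (|θ| + β)` from the origin, if at all. -/
lemma mem_wedge_polar_iff {h β ρ θ : ℝ} (hh : 0 < h) (hβ0 : 0 ≤ β) (hβ : β ≤ Real.pi / 2)
    (hρ : 0 < ρ) (hθ : |θ| < Real.pi) :
    (h ≤ Real.cos β * (ρ * Real.cos θ) + Real.sin β * (ρ * Real.sin θ)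
      ∧ h ≤ Real.cos β * (ρ * Real.cos θ) - Real.sin β * (ρ * Real.sin θ))
      ↔ |θ| < Real.pi / 2 - β ∧ h / Real.cos (|θ| + β) ≤ ρ := by
  have hsβ : 0 ≤ Real.sin β := Real.sin_nonneg_of_nonneg_of_le_pi hβ0 (by linarith [Real.pi_pos])
  have hs : 0 ≤ Real.sin |θ| := Real.sin_nonneg_of_nonneg_of_le_pi (abs_nonneg _) hθ.le
  have hcos : Real.cos (|θ| + β) = Real.cos θ * Real.cos β - Real.sin |θ| * Real.sin β := by
    rw [Real.cos_add, Real.cos_abs]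
  have hsc : 0 ≤ ρ * (Real.sin |θ| * Real.sin β) := by positivity
  have h1 : (h ≤ Real.cos β * (ρ * Real.cos θ) + Real.sin β * (ρ * Real.sin θ)
      ∧ h ≤ Real.cos β * (ρ * Real.cos θ) - Real.sin β * (ρ * Real.sin θ))
      ↔ h ≤ ρ * Real.cos (|θ| + β) := by
    rw [hcos]
    rcases abs_cases θ with ⟨e, _⟩ | ⟨e, _⟩
    · rw [e] at hsc ⊢
      constructor
      · rintro ⟨_, h2⟩
        nlinarith
      · intro h2
        constructor <;> nlinarith
    · rw [e, Real.sin_neg] at hsc ⊢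
      constructor
      · rintro ⟨h2, _⟩
        nlinarith
      · intro h2
        constructor <;> nlinarith
  rw [h1]
  constructor
  · intro h2
    have hc : 0 < Real.cos (|θ| + β) := by
      by_contra hc
      have : ρ * Real.cos (|θ| + β) ≤ 0 := mul_nonpos_of_nonneg_of_nonpos hρ.le (not_lt.1 hc)
      linarith
    refine ⟨?_, by rw [div_le_iff₀ hc]; exact h2⟩
    by_contra h3
    have : Real.cos (|θ| + β) ≤ 0 := Real.cos_nonpos_of_pi_div_two_le_of_le (by linarith)
      (by linarith)
    linarith
  · rintro ⟨h2, h3⟩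
    have hc : 0 < Real.cos (|θ| + β) := Real.cos_pos_of_mem_Ioo
      ⟨by linarith [Real.pi_pos, abs_nonneg θ], by linarith⟩
    rwa [div_le_iff₀ hc] at h3

/-- The radial part of the Gaussian integral over a wedge, in polar coordinates. -/
lemma lintegral_wedge_ray {h β θ : ℝ} (hh : 0 < h) (hβ0 : 0 ≤ β) (hβ : β ≤ Real.pi / 2)
    (hθ : |θ| < Real.pi) :
    ∫⁻ ρ in Set.Ioi (0 : ℝ), ENNReal.ofReal ρ *
      ({g : Vec 2 | h ≤ Real.cos β * g 0 + Real.sin β * g 1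
          ∧ h ≤ Real.cos β * g 0 - Real.sin β * g 1}.indicator (fun _ => 1)
          (!₂[ρ * Real.cos θ, ρ * Real.sin θ] : Vec 2)
        * ENNReal.ofReal (1 / (2 * Real.pi)
          * Real.exp (-((ρ * Real.cos θ) ^ 2 + (ρ * Real.sin θ) ^ 2) / 2)))
      = ENNReal.ofReal ((Set.Iio (Real.pi / 2 - β)).indicator (fun x =>
        1 / (2 * Real.pi) * Real.exp (-(h ^ 2 / 2) / Real.cos (x + β) ^ 2)) |θ|) := by
  have hint : ∀ ρ ∈ Set.Ioi (0 : ℝ), ENNReal.ofReal ρ *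
      ({g : Vec 2 | h ≤ Real.cos β * g 0 + Real.sin β * g 1
          ∧ h ≤ Real.cos β * g 0 - Real.sin β * g 1}.indicator (fun _ => 1)
          (!₂[ρ * Real.cos θ, ρ * Real.sin θ] : Vec 2)
        * ENNReal.ofReal (1 / (2 * Real.pi)
          * Real.exp (-((ρ * Real.cos θ) ^ 2 + (ρ * Real.sin θ) ^ 2) / 2)))
      = {ρ | |θ| < Real.pi / 2 - β ∧ h / Real.cos (|θ| + β) ≤ ρ}.indicator
        (fun ρ => ENNReal.ofReal (1 / (2 * Real.pi)) *
          ENNReal.ofReal (ρ * Real.exp (-ρ ^ 2 / 2))) ρ := by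
    intro ρ hρ
    have hiff := mem_wedge_polar_iff hh hβ0 hβ hρ hθ
    have e : (ρ * Real.cos θ) ^ 2 + (ρ * Real.sin θ) ^ 2 = ρ ^ 2 := by
      nlinarith [Real.sin_sq_add_cos_sq θ]
    by_cases hm : |θ| < Real.pi / 2 - β ∧ h / Real.cos (|θ| + β) ≤ ρ
    · rw [Set.indicator_of_mem (by simpa using hiff.2 hm), Set.indicator_of_mem (by exact hm), e,
        one_mul, ← ENNReal.ofReal_mul (le_of_lt hρ), ← ENNReal.ofReal_mul (by positivity)]
      congr 1
      ring
    · rw [Set.indicator_of_notMem (by simpa using fun h1 h2 => hm (hiff.1 ⟨h1, h2⟩)),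
        Set.indicator_of_notMem (by exact hm)]
      simp
  rw [setLIntegral_congr_fun measurableSet_Ioi hint]
  by_cases hlt : |θ| < Real.pi / 2 - β
  · have hc : 0 < Real.cos (|θ| + β) := Real.cos_pos_of_mem_Ioo
      ⟨by linarith [Real.pi_pos, abs_nonneg θ], by linarith⟩
    have hset : {ρ | |θ| < Real.pi / 2 - β ∧ h / Real.cos (|θ| + β) ≤ ρ}
        = Set.Ici (h / Real.cos (|θ| + β)) := by
      ext ρ
      simp [hlt]
    have hsub : Set.Ici (h / Real.cos (|θ| + β)) ∩ Set.Ioi 0 = Set.Ici (h / Real.cos (|θ| + β)) :=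
      Set.inter_eq_left.2 fun x hx => lt_of_lt_of_le (div_pos hh hc) hx
    rw [hset, lintegral_indicator measurableSet_Ici, Measure.restrict_restrict measurableSet_Ici,
      hsub, lintegral_const_mul _ (by fun_prop), lintegral_Ici_mul_exp_neg_sq (by positivity),
      ← ENNReal.ofReal_mul (by positivity), Set.indicator_of_mem (by exact hlt)]
    congr 3
    rw [div_pow]
    ring
  · rw [Set.indicator_of_notMem (by exact hlt)]
    have hset : {ρ | |θ| < Real.pi / 2 - β ∧ h / Real.cos (|θ| + β) ≤ ρ} = ∅ := by
      ext ρ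
      simp [hlt]
    simp [hset]

lemma integrable_exp_neg_div_cos_sq (h a b : ℝ) :
    IntervalIntegrable (fun θ => Real.exp (-(h ^ 2 / 2) / Real.cos θ ^ 2)) volume a b := by
  refine (intervalIntegrable_const (c := (1 : ℝ))).mono_fun ?_ (Eventually.of_forall fun x => ?_)
  · exact Measurable.aestronglyMeasurable (by fun_prop)
  · simp only [norm_one, Real.norm_eq_abs, abs_of_pos (Real.exp_pos _), Real.exp_le_one_iff]
    exact div_nonpos_of_nonpos_of_nonneg (by nlinarith [sq_nonneg h]) (sq_nonneg _)

/-- The wedge is the rotated orthant, placed symmetrically about the first axis so that the polar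
integrand depends on `|θ|` only. -/
lemma stdGaussian_wedge {h t : ℝ} (hh : 0 < h) :
    (stdGaussian (Vec 2)).real
      {g | h ≤ Real.cos (Real.arccos t / 2) * g 0 + Real.sin (Real.arccos t / 2) * g 1
        ∧ h ≤ Real.cos (Real.arccos t / 2) * g 0 - Real.sin (Real.arccos t / 2) * g 1}
      = orthantProb h t := by
  set β := Real.arccos t / 2 with hβ
  have hβ0 : 0 ≤ β := by have := Real.arccos_nonneg t; positivity
  have hβ1 : β ≤ Real.pi / 2 := by have := Real.arccos_le_pi t; rw [hβ]; linarith
  set A : Set (Vec 2) := {g | h ≤ Real.cos β * g 0 + Real.sin β * g 1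
        ∧ h ≤ Real.cos β * g 0 - Real.sin β * g 1} with hAdef
  have hA : MeasurableSet A := by
    apply MeasurableSet.inter
    · exact measurableSet_le measurable_const
        (g := fun g : Vec 2 => Real.cos β * g 0 + Real.sin β * g 1) (by fun_prop)
    · exact measurableSet_le measurable_const
        (g := fun g : Vec 2 => Real.cos β * g 0 - Real.sin β * g 1) (by fun_prop)
  set F : ℝ → ℝ := (Set.Iio (Real.pi / 2 - β)).indicator (fun x =>
        1 / (2 * Real.pi) * Real.exp (-(h ^ 2 / 2) / Real.cos (x + β) ^ 2)) with hF
  have hFm : Measurable F := Measurable.indicator (by fun_prop) measurableSet_Iio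
  have hF0 : ∀ x, 0 ≤ F x := fun x => Set.indicator_nonneg (fun _ _ => by positivity) _
  have hpolar : stdGaussian (Vec 2) A = ∫⁻ θ in Set.Ioo (-Real.pi) Real.pi,
      ENNReal.ofReal (F |θ|) := by
    have hTm : Measurable (fun p : ℝ × ℝ => (!₂[p.1, p.2] : Vec 2)) :=
      Continuous.measurable (by fun_prop)
    have hI : Measurable (A.indicator (fun _ => (1 : ENNReal))) := measurable_const.indicator hA
    rw [stdGaussian_two_apply hA, ← lintegral_comp_polarCoord_symm, polarCoord_target,
      Measure.volume_eq_prod, ← Measure.prod_restrict, lintegral_prod_symm]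
    · refine setLIntegral_congr_fun measurableSet_Ioo fun θ hθ => ?_
      exact lintegral_wedge_ray hh hβ0 hβ1 (abs_lt.2 hθ)
    · refine Measurable.aemeasurable ?_
      have h1 := (hI.comp hTm).comp continuous_polarCoord_symm.measurable
      refine Measurable.mul (by fun_prop) (Measurable.mul h1 ?_)
      have := continuous_polarCoord_symm.measurable
      fun_prop
  have hsupp : ∫⁻ θ in Set.Ioo (-Real.pi) Real.pi, ENNReal.ofReal (F |θ|)
      = ∫⁻ θ, ENNReal.ofReal (F |θ|) := by
    rw [← lintegral_indicator measurableSet_Ioo]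
    refine lintegral_congr fun θ => ?_
    by_cases hθ : θ ∈ Set.Ioo (-Real.pi) Real.pi
    · rw [Set.indicator_of_mem hθ]
    · rw [Set.indicator_of_notMem hθ, hF, Set.indicator_of_notMem]
      · simp
      · intro h2
        exact hθ (abs_lt.1 (lt_trans h2 (by linarith [Real.pi_pos])))
  rw [measureReal_def, hpolar, hsupp, ← integral_eq_lintegral_of_nonneg_ae
    (Eventually.of_forall fun θ => hF0 _)
    (hFm.comp measurable_abs).aestronglyMeasurable, integral_comp_abs (f := F), hF,
    setIntegral_indicator measurableSet_Iio, Set.Ioi_inter_Iio, ← integral_Ioc_eq_integral_Ioo,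
    ← intervalIntegral.integral_of_le (by linarith), intervalIntegral.integral_const_mul,
    intervalIntegral.integral_comp_add_right
      (fun x => Real.exp (-(h ^ 2 / 2) / Real.cos x ^ 2)), orthantProb]
  rw [zero_add, sub_add_cancel, ← hβ]
  ring

lemma meanScore_eq_orthantProb {m : ℕ} {r t : ℝ} (hh : 0 < threshold m r) (ht1 : -1 ≤ t)
    (ht2 : t ≤ 1) : meanScore m r t = orthantProb (threshold m r) t := by
  set β := Real.arccos t / 2 with hβ
  have hx : ∀ s : ℝ, s ^ 2 = Real.sin β ^ 2 → ‖(!₂[Real.cos β, s] : Vec 2)‖ = 1 := by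
    intro s hs
    rw [EuclideanSpace.norm_eq, Real.sqrt_eq_one]
    simp [hs]
  have hin : inner ℝ (!₂[Real.cos β, Real.sin β] : Vec 2) !₂[Real.cos β, -Real.sin β] = t := by
    have : Real.cos (2 * β) = t := by
      rw [hβ, mul_div_cancel₀ _ two_ne_zero, Real.cos_arccos ht1 ht2]
    rw [← this, Real.cos_two_mul']
    simp [PiLp.inner_apply, Fin.sum_univ_two]
    ring
  rw [← stdGaussian_wedge hh, ← hin, ← stdGaussian_real_eq_meanScore m r _ _ (hx _ rfl)
    (hx (-Real.sin β) (by ring)), hin]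
  congr 1
  ext g
  simp [PiLp.inner_apply, Fin.sum_univ_two, ← hβ, sub_eq_add_neg]

lemma orthantProb_nonneg (h t : ℝ) : 0 ≤ orthantProb h t := by
  have := Real.arccos_le_pi t
  refine mul_nonneg (by positivity) (intervalIntegral.integral_nonneg (by linarith) ?_)
  exact fun _ _ => (Real.exp_pos _).le

lemma orthantProb_mono (h : ℝ) : Monotone (orthantProb h) := by
  intro t s hts
  have h1 : Real.arccos s ≤ Real.arccos t := Real.antitone_arccos hts
  have h2 := Real.arccos_le_pi t
  refine mul_le_mul_of_nonneg_left ?_ (by positivity)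
  refine intervalIntegral.integral_mono_interval (by linarith) (by linarith) le_rfl
    (Eventually.of_forall fun _ => (Real.exp_pos _).le) (integrable_exp_neg_div_cos_sq _ _ _)

lemma tendsto_orthantProb_neg_one (h : ℝ) : Tendsto (orthantProb h) (𝓝 (-1)) (𝓝 0) := by
  have hc : Continuous (orthantProb h) := by
    unfold orthantProb
    refine continuous_const.mul ?_
    simp_rw [intervalIntegral.integral_symm (Real.pi / 2)]
    refine ((intervalIntegral.continuous_primitive
      (fun a b => integrable_exp_neg_div_cos_sq h a b) (Real.pi / 2)).comp ?_).neg
    exact Real.continuous_arccos.div_const 2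
  have h0 : orthantProb h (-1) = 0 := by simp [orthantProb]
  exact h0 ▸ hc.tendsto (-1)

/-- Plackett's identity: the derivative of the orthant probability with respect to the correlation
is the bivariate normal density at the corner of the orthant. -/
lemma hasDerivAt_orthantProb (h : ℝ) {t : ℝ} (ht1 : -1 < t) (ht2 : t < 1) :
    HasDerivAt (orthantProb h)
      (Real.exp (-h ^ 2 / (1 + t)) / (2 * Real.pi * Real.sqrt (1 - t ^ 2))) t := by
  set β := Real.arccos t / 2 with hβ
  have hcos : 2 * Real.cos β ^ 2 = 1 + t := by
    have := Real.cos_two_mul β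
    rw [hβ, mul_div_cancel₀ _ two_ne_zero, Real.cos_arccos ht1.le ht2.le] at this
    rw [hβ]
    linarith
  have hc0 : Real.cos β ^ 2 ≠ 0 := by
    intro h0
    rw [h0] at hcos
    linarith
  have hcont : ContinuousAt (fun θ => Real.exp (-(h ^ 2 / 2) / Real.cos θ ^ 2)) β := by
    refine Real.continuous_exp.continuousAt.comp (ContinuousAt.div continuousAt_const ?_ hc0)
    exact (Real.continuous_cos.pow 2).continuousAt
  have h1 := intervalIntegral.integral_hasDerivAt_left
    (integrable_exp_neg_div_cos_sq h β (Real.pi / 2))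
    (Measurable.stronglyMeasurable (by fun_prop)).stronglyMeasurableAtFilter hcont
  have h2 : HasDerivAt (fun t => Real.arccos t / 2) (-(1 / Real.sqrt (1 - t ^ 2)) / 2) t :=
    (Real.hasDerivAt_arccos ht1.ne' ht2.ne).div_const 2
  have h3 := (h1.comp t h2).const_mul (1 / Real.pi)
  refine h3.congr_deriv ?_
  have e : -(h ^ 2 / 2) / Real.cos β ^ 2 = -h ^ 2 / (1 + t) := by
    rw [← hcos]
    field_simp
  rw [e]
  have : 0 < Real.sqrt (1 - t ^ 2) := Real.sqrt_pos.2 (by nlinarith)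
  field_simp

/-! ### Asymptotics of the mean score -/

/-- The leading coefficient in `P(v ≥ h, w ≥ h) ∼ cornerWeight t · h⁻² · exp (-h² / (1 + t))`. -/
noncomputable def cornerWeight (t : ℝ) : ℝ := (1 + t) ^ 2 / (2 * Real.pi * Real.sqrt (1 - t ^ 2))

lemma cornerWeight_pos {t : ℝ} (h1 : -1 < t) (h2 : t < 1) : 0 < cornerWeight t := by
  have : 0 < Real.sqrt (1 - t ^ 2) := Real.sqrt_pos.2 (by nlinarith)
  have : 0 < 1 + t := by linarith
  unfold cornerWeight
  positivity

lemma cornerWeight_mono {s t : ℝ} (h1 : -1 < s) (hst : s ≤ t) (h2 : t < 1) :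
    cornerWeight s ≤ cornerWeight t := by
  have e : ∀ u : ℝ, -1 < u → u < 1 → cornerWeight u
      = (1 + u) * Real.sqrt (1 + u) / (2 * Real.pi * Real.sqrt (1 - u)) := by
    intro u hu1 hu2
    have p1 : 0 < Real.sqrt (1 + u) := Real.sqrt_pos.2 (by linarith)
    have p2 : 0 < Real.sqrt (1 - u) := Real.sqrt_pos.2 (by linarith)
    have hs : Real.sqrt (1 - u ^ 2) = Real.sqrt (1 + u) * Real.sqrt (1 - u) := by
      rw [← Real.sqrt_mul (by linarith)]
      congr 1
      ring
    have hq : Real.sqrt (1 + u) * Real.sqrt (1 + u) = 1 + u := Real.mul_self_sqrt (by linarith)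
    rw [cornerWeight, hs, div_eq_div_iff (by positivity) (by positivity)]
    linear_combination
      (-(1 + u) * 2 * Real.pi * Real.sqrt (1 - u)) * hq
  rw [e s h1 (by linarith), e t (by linarith) h2]
  have : 0 < Real.sqrt (1 - t) := Real.sqrt_pos.2 (by linarith)
  have : 0 < 1 + s := by linarith
  have : 0 < 1 + t := by linarith
  gcongr

lemma continuousAt_cornerWeight {t : ℝ} (h1 : -1 < t) (h2 : t < 1) :
    ContinuousAt cornerWeight t := by
  have : 0 < Real.sqrt (1 - t ^ 2) := Real.sqrt_pos.2 (by nlinarith)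
  unfold cornerWeight
  refine ContinuousAt.div (by fun_prop) (by fun_prop) (by positivity)

/-- Cauchy's mean value theorem for the orthant probability against `exp (-h² / (1 + t))`. -/
lemma exists_orthantProb_sub_eq (h : ℝ) {a b : ℝ} (ha : -1 < a) (hab : a < b) (hb : b < 1) :
    ∃ c ∈ Set.Ioo a b, h ^ 2 * (orthantProb h b - orthantProb h a)
      = cornerWeight c * (Real.exp (-h ^ 2 / (1 + b)) - Real.exp (-h ^ 2 / (1 + a))) := by
  have hφ : ∀ x ∈ Set.Icc a b, HasDerivAt (fun s => Real.exp (-h ^ 2 / (1 + s)))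
      (Real.exp (-h ^ 2 / (1 + x)) * (h ^ 2 / (1 + x) ^ 2)) x := by
    intro x hx
    have hx0 : 1 + x ≠ 0 := by linarith [hx.1]
    have := ((hasDerivAt_const x (-h ^ 2)).div ((hasDerivAt_id x).const_add 1) hx0).exp
    refine this.congr_deriv ?_
    simp
  have hM : ∀ x ∈ Set.Icc a b, HasDerivAt (orthantProb h) _ x := fun x hx =>
    hasDerivAt_orthantProb h (by linarith [hx.1]) (by linarith [hx.2])
  obtain ⟨c, hc, hceq⟩ := exists_ratio_hasDerivAt_eq_ratio_slope (orthantProb h)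
    _ hab (fun x hx => (hM x hx).continuousAt.continuousWithinAt)
    (fun x hx => hM x (Set.Ioo_subset_Icc_self hx))
    (fun s => Real.exp (-h ^ 2 / (1 + s))) _
    (fun x hx => (hφ x hx).continuousAt.continuousWithinAt)
    (fun x hx => hφ x (Set.Ioo_subset_Icc_self hx))
  refine ⟨c, hc, ?_⟩
  have hc1 : 0 < 1 + c := by linarith [hc.1]
  have hs : 0 < Real.sqrt (1 - c ^ 2) := Real.sqrt_pos.2 (by nlinarith [hc.1, hc.2])
  have he := Real.exp_pos (-h ^ 2 / (1 + c))
  rw [cornerWeight]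
  field_simp at hceq ⊢
  linear_combination -hceq

lemma sq_mul_orthantProb_le {h t : ℝ} (h1 : -1 < t) (h2 : t < 1) :
    h ^ 2 * orthantProb h t ≤ cornerWeight t * Real.exp (-h ^ 2 / (1 + t)) := by
  have hlim : Tendsto (fun a => h ^ 2 * (orthantProb h t - orthantProb h a)) (𝓝[>] (-1))
      (𝓝 (h ^ 2 * orthantProb h t)) := by
    have := ((tendsto_orthantProb_neg_one h).const_sub (orthantProb h t)).const_mul (h ^ 2)
    rw [sub_zero] at this
    exact this.mono_left nhdsWithin_le_nhds
  refine le_of_tendsto hlim ?_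
  filter_upwards [Ioo_mem_nhdsGT h1] with a ha
  obtain ⟨c, hc, e⟩ := exists_orthantProb_sub_eq h ha.1 ha.2 h2
  rw [e]
  have hw := cornerWeight_mono (by linarith [ha.1, hc.1]) hc.2.le h2
  have hc0 := cornerWeight_pos (by linarith [ha.1, hc.1]) (hc.2.trans h2)
  calc _ ≤ cornerWeight c * Real.exp (-h ^ 2 / (1 + t)) := by
        gcongr
        linarith [Real.exp_pos (-h ^ 2 / (1 + a))]
    _ ≤ _ := by gcongr

lemma le_sq_mul_orthantProb {h a t : ℝ} (h1 : -1 < a) (hat : a < t) (h2 : t < 1) :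
    cornerWeight a * (Real.exp (-h ^ 2 / (1 + t)) - Real.exp (-h ^ 2 / (1 + a)))
      ≤ h ^ 2 * orthantProb h t := by
  obtain ⟨c, hc, e⟩ := exists_orthantProb_sub_eq h h1 hat h2
  have hw := cornerWeight_mono h1 hc.1.le (hc.2.trans h2)
  have hexp : Real.exp (-h ^ 2 / (1 + a)) ≤ Real.exp (-h ^ 2 / (1 + t)) := by
    have : 0 < 1 + a := by linarith
    rw [Real.exp_le_exp, neg_div, neg_div, neg_le_neg_iff]
    gcongr
  calc _ ≤ cornerWeight c * (Real.exp (-h ^ 2 / (1 + t)) - Real.exp (-h ^ 2 / (1 + a))) :=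
        mul_le_mul_of_nonneg_right hw (by linarith)
    _ = h ^ 2 * (orthantProb h t - orthantProb h a) := e.symm
    _ ≤ _ := by
        have := mul_nonneg (sq_nonneg h) (orthantProb_nonneg h a)
        linarith

/-- Tail asymptotics of the orthant probability. -/
lemma tendsto_orthantProb_scaled {t : ℝ} (h1 : -1 < t) (h2 : t < 1) :
    Tendsto (fun h => h ^ 2 * Real.exp (h ^ 2 / (1 + t)) * orthantProb h t) atTop
      (𝓝 (cornerWeight t)) := by
  refine tendsto_order.2 ⟨fun u hu => ?_, fun u hu => Eventually.of_forall fun h => ?_⟩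
  · have hev : ∀ᶠ a in 𝓝[<] t, u < cornerWeight a :=
      nhdsWithin_le_nhds ((continuousAt_cornerWeight h1 h2).eventually_const_lt hu)
    obtain ⟨a, hau, ha1, hat⟩ := (hev.and (Ioo_mem_nhdsLT h1)).exists
    have hgap : 1 / (1 + t) - 1 / (1 + a) < 0 := by
      have : 1 / (1 + t) < 1 / (1 + a) := one_div_lt_one_div_of_lt (by linarith) (by linarith)
      linarith
    have hlim : Tendsto (fun h : ℝ => cornerWeight a
        * (1 - Real.exp ((1 / (1 + t) - 1 / (1 + a)) * h ^ 2))) atTop (𝓝 (cornerWeight a)) := by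
      have := (Real.tendsto_exp_atBot.comp
        ((tendsto_pow_atTop (α := ℝ) two_ne_zero).const_mul_atTop_of_neg hgap))
      simpa using (this.const_sub 1).const_mul (cornerWeight a)
    filter_upwards [hlim.eventually_const_lt hau] with h hh
    refine hh.trans_le ?_
    have := mul_le_mul_of_nonneg_right (le_sq_mul_orthantProb (h := h) ha1 hat h2)
      (Real.exp_pos (h ^ 2 / (1 + t))).le
    rw [mul_assoc, sub_mul, ← Real.exp_add, ← Real.exp_add] at this
    refine (le_of_eq ?_).trans (this.trans (le_of_eq (by ring)))
    congr 2
    · rw [neg_div, neg_add_cancel, Real.exp_zero]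
    · congr 1
      ring
  · refine lt_of_le_of_lt ?_ hu
    have := mul_le_mul_of_nonneg_right (sq_mul_orthantProb_le (h := h) h1 h2)
      (Real.exp_pos (h ^ 2 / (1 + t))).le
    rw [mul_assoc (cornerWeight t), ← Real.exp_add, neg_div, neg_add_cancel, Real.exp_zero,
      mul_one] at this
    linarith

/-- First-order expansion of the orthant probability in the correlation: the increment over
`[lam - δ, lam]` is `δ` times the density at the corner, provided `h² δ → 0`. -/
lemma exists_orthantProb_increment {lam : ℝ} (h1 : -1 < lam) (h2 : lam < 1) {h δ : ℕ → ℝ}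
    (hδ : Tendsto δ atTop (𝓝 0)) (hhδ : Tendsto (fun m => h m ^ 2 * δ m) atTop (𝓝 0)) :
    ∃ ρ : ℕ → ℝ, Tendsto ρ atTop (𝓝 (1 / (2 * Real.pi * Real.sqrt (1 - lam ^ 2)))) ∧
      ∀ᶠ m in atTop, Real.exp (h m ^ 2 / (1 + lam))
        * (orthantProb (h m) lam - orthantProb (h m) (lam - δ m)) = δ m * ρ m := by
  have hmvt : ∀ m, -1 < lam - δ m → lam - δ m < 1 → ∃ ξ, |ξ - lam| ≤ |δ m| ∧
      orthantProb (h m) lam - orthantProb (h m) (lam - δ m) = δ m *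
        (Real.exp (-h m ^ 2 / (1 + ξ)) / (2 * Real.pi * Real.sqrt (1 - ξ ^ 2))) := by
    intro m hm1 hm2
    rcases lt_trichotomy (δ m) 0 with hneg | hz | hpos
    · obtain ⟨ξ, hξ, e⟩ := exists_hasDerivAt_eq_slope (orthantProb (h m)) _
        (show lam < lam - δ m by linarith)
        (fun x hx => (hasDerivAt_orthantProb (h m) (by linarith [hx.1])
          (by linarith [hx.2])).continuousAt.continuousWithinAt)
        (fun x hx => hasDerivAt_orthantProb (h m) (by linarith [hx.1]) (by linarith [hx.2]))
      refine ⟨ξ, ?_, ?_⟩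
      · rw [abs_of_neg hneg, abs_le]
        constructor <;> linarith [hξ.1, hξ.2]
      · rw [e]
        have : lam - δ m - lam ≠ 0 := by linarith
        have : δ m ≠ 0 := hneg.ne
        field_simp
        ring
    · exact ⟨lam, by simp [hz], by simp [hz]⟩
    · obtain ⟨ξ, hξ, e⟩ := exists_hasDerivAt_eq_slope (orthantProb (h m)) _
        (show lam - δ m < lam by linarith)
        (fun x hx => (hasDerivAt_orthantProb (h m) (by linarith [hx.1])
          (by linarith [hx.2])).continuousAt.continuousWithinAt)
        (fun x hx => hasDerivAt_orthantProb (h m) (by linarith [hx.1]) (by linarith [hx.2]))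
      refine ⟨ξ, ?_, ?_⟩
      · rw [abs_of_pos hpos, abs_le]
        constructor <;> linarith [hξ.1, hξ.2]
      · rw [e]
        have : lam - (lam - δ m) ≠ 0 := by linarith
        have : δ m ≠ 0 := hpos.ne'
        field_simp
        ring
  have hmvt' : ∀ m, ∃ ξ, |ξ - lam| ≤ |δ m| ∧ (-1 < lam - δ m → lam - δ m < 1 →
      orthantProb (h m) lam - orthantProb (h m) (lam - δ m) = δ m *
        (Real.exp (-h m ^ 2 / (1 + ξ)) / (2 * Real.pi * Real.sqrt (1 - ξ ^ 2)))) := by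
    intro m
    by_cases hm : -1 < lam - δ m ∧ lam - δ m < 1
    · obtain ⟨ξ, a, b⟩ := hmvt m hm.1 hm.2
      exact ⟨ξ, a, fun _ _ => b⟩
    · exact ⟨lam, by simp, fun a b => absurd ⟨a, b⟩ hm⟩
  choose ξ hξ1 hξ2 using hmvt'
  have hξ : Tendsto ξ atTop (𝓝 lam) := by
    rw [tendsto_iff_norm_sub_tendsto_zero]
    exact squeeze_zero (fun _ => norm_nonneg _) hξ1 (by simpa using hδ.abs)
  have hhξ : Tendsto (fun m => h m ^ 2 * (ξ m - lam)) atTop (𝓝 0) := by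
    refine squeeze_zero_norm (fun m => ?_) (by simpa [abs_mul] using hhδ.abs)
    rw [Real.norm_eq_abs, abs_mul, abs_of_nonneg (sq_nonneg (h m))]
    exact mul_le_mul_of_nonneg_left (hξ1 m) (sq_nonneg _)
  refine ⟨fun m => Real.exp (h m ^ 2 * (ξ m - lam) / ((1 + lam) * (1 + ξ m)))
    / (2 * Real.pi * Real.sqrt (1 - ξ m ^ 2)), ?_, ?_⟩
  · have hs : 0 < Real.sqrt (1 - lam ^ 2) := Real.sqrt_pos.2 (by nlinarith)
    have hl : 0 < 1 + lam := by linarith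
    have e1 : Tendsto (fun m => h m ^ 2 * (ξ m - lam) / ((1 + lam) * (1 + ξ m))) atTop
        (𝓝 (0 / ((1 + lam) * (1 + lam)))) :=
      hhξ.div ((hξ.const_add 1).const_mul _) (by positivity)
    rw [zero_div] at e1
    have e2 := (Real.continuous_exp.tendsto _).comp e1
    rw [Real.exp_zero] at e2
    refine e2.div ?_ (by positivity)
    exact (((hξ.pow 2).const_sub 1).sqrt).const_mul _
  · have hd : Tendsto (fun m => lam - δ m) atTop (𝓝 lam) := by simpa using hδ.const_sub lam
    filter_upwards [hd.eventually_const_lt h1, hd.eventually_lt_const h2,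
      hξ.eventually_const_lt h1] with m hm1 hm2 hm3
    rw [hξ2 m hm1 hm2]
    have a1 : 1 + lam ≠ 0 := by linarith
    have a2 : 1 + ξ m ≠ 0 := by linarith
    have : Real.exp (h m ^ 2 * (ξ m - lam) / ((1 + lam) * (1 + ξ m)))
        = Real.exp (h m ^ 2 / (1 + lam)) * Real.exp (-h m ^ 2 / (1 + ξ m)) := by
      rw [← Real.exp_add]
      congr 1
      field_simp
      ring
    rw [this]
    ring

lemma sq_threshold {m : ℕ} {r : ℝ} (hr : 0 < r) : threshold m r ^ 2 = 2 * r * Real.log m :=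
  Real.sq_sqrt (mul_nonneg (by positivity) (Real.log_natCast_nonneg m))

lemma tendsto_threshold {r : ℝ} (hr : 0 < r) :
    Tendsto (fun m : ℕ => threshold m r) atTop atTop :=
  Real.tendsto_sqrt_atTop.comp ((Real.tendsto_log_atTop.comp
    tendsto_natCast_atTop_atTop).const_mul_atTop (by positivity))

lemma meanScore_nonneg (m : ℕ) (r t : ℝ) : 0 ≤ meanScore m r t := measureReal_nonneg

lemma meanScore_le_one (m : ℕ) (r t : ℝ) : meanScore m r t ≤ 1 := measureReal_le_one

/-- The exponential factor of the expected number of hits at correlation `lam` is a power of `m`;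
the exponent is positive exactly when `2 * r - 1 < lam`. -/
lemma mul_exp_neg_sq_threshold {m : ℕ} {r lam : ℝ} (hr : 0 < r) (h1 : -1 < lam) (hm : 0 < m) :
    (m : ℝ) * Real.exp (-threshold m r ^ 2 / (1 + lam))
      = (m : ℝ) ^ ((lam - (2 * r - 1)) / (1 + lam)) := by
  have hm' : (0 : ℝ) < m := Nat.cast_pos.2 hm
  have hl : 1 + lam ≠ 0 := by linarith
  rw [sq_threshold hr, Real.rpow_def_of_pos hm']
  nth_rewrite 1 [← Real.exp_log hm']
  rw [← Real.exp_add]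
  congr 1
  field_simp
  ring

lemma eps_eq {m : ℕ} {r lam η : ℝ} (hm : 0 < m) :
    eps lam r m η = Real.sqrt (2 * Real.pi) * (1 + lam) * (1 - lam ^ 2) ^ (1 / 4 : ℝ) * η
      / (threshold m r * Real.sqrt ((m : ℝ) ^ ((lam - (2 * r - 1)) / (1 + lam)))) := by
  have hm' : (0 : ℝ) < m := Nat.cast_pos.2 hm
  rw [eps, epsConst, Real.rpow_neg hm'.le, Real.sqrt_eq_rpow ((m : ℝ) ^ _),
    ← Real.rpow_mul hm'.le, threshold]
  have : (lam - (2 * r - 1)) / (2 * (1 + lam)) = (lam - (2 * r - 1)) / (1 + lam) * (1 / 2) := by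
    rw [div_mul_div_comm, mul_one, mul_comm 2 (1 + lam)]
  rw [this, ← div_eq_mul_inv, div_mul_eq_mul_div, div_div]

lemma tendsto_threshold_pow_div_rpow {r a : ℝ} (hr : 0 < r) (ha : 0 < a) :
    Tendsto (fun m : ℕ => threshold m r ^ 2 / Real.sqrt ((m : ℝ) ^ a)) atTop (𝓝 0) := by
  have h := (isLittleO_log_rpow_atTop (half_pos ha)).tendsto_div_nhds_zero.comp
    tendsto_natCast_atTop_atTop
  have h2 := h.const_mul (2 * r)
  rw [mul_zero] at h2
  refine h2.congr fun m => ?_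
  rw [sq_threshold hr, Real.sqrt_eq_rpow, ← Real.rpow_mul (Nat.cast_nonneg m)]
  simp only [Function.comp]
  rw [show a * (1 / 2) = a / 2 by ring]
  ring

section Scaling

variable {r lam : ℝ}

lemma tendsto_sq_threshold_mul_eps (hr : 0 < r) (hlam : 2 * r - 1 < lam) {η : ℕ → ℝ} {η₀ : ℝ}
    (hη : Tendsto η atTop (𝓝 η₀)) :
    Tendsto (fun m : ℕ => threshold m r ^ 2 * eps lam r m (η m)) atTop (𝓝 0) := by
  have ha : 0 < (lam - (2 * r - 1)) / (1 + lam) := div_pos (by linarith) (by linarith)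
  have h1 := (tendsto_threshold_pow_div_rpow hr ha).mul
    (tendsto_inv_atTop_zero.comp (tendsto_threshold hr))
  have h2 := h1.mul (hη.const_mul (Real.sqrt (2 * Real.pi) * (1 + lam)
    * (1 - lam ^ 2) ^ (1 / 4 : ℝ)))
  rw [mul_zero, zero_mul] at h2
  refine h2.congr' ?_
  filter_upwards [eventually_gt_atTop 0] with m hm
  rw [eps_eq hm]
  simp only [Function.comp]
  ring

lemma tendsto_eps (hr : 0 < r) (hlam : 2 * r - 1 < lam) {η : ℕ → ℝ} {η₀ : ℝ}
    (hη : Tendsto η atTop (𝓝 η₀)) :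
    Tendsto (fun m : ℕ => eps lam r m (η m)) atTop (𝓝 0) := by
  have h1 := (tendsto_sq_threshold_mul_eps hr hlam hη).mul
    ((tendsto_inv_atTop_zero.comp (tendsto_threshold hr)).pow 2)
  rw [zero_mul] at h1
  refine h1.congr' ?_
  filter_upwards [(tendsto_threshold hr).eventually_gt_atTop 0] with m hm
  simp only [Function.comp]
  field_simp

lemma tendsto_sq_threshold_mul_meanScore (hr : 0 < r) (h1 : -1 < lam) (h2 : lam < 1) :
    Tendsto (fun m : ℕ => threshold m r ^ 2 * Real.exp (threshold m r ^ 2 / (1 + lam))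
      * meanScore m r lam) atTop (𝓝 (cornerWeight lam)) := by
  refine ((tendsto_orthantProb_scaled h1 h2).comp (tendsto_threshold hr)).congr' ?_
  filter_upwards [(tendsto_threshold hr).eventually_gt_atTop 0] with m hm
  rw [meanScore_eq_orthantProb hm h1.le h2.le]
  rfl

lemma tendsto_meanScore_zero (hr : 0 < r) (h1 : -1 < lam) (h2 : lam < 1) :
    Tendsto (fun m : ℕ => meanScore m r lam) atTop (𝓝 0) := by
  have hb := (tendsto_sq_threshold_mul_meanScore hr h1 h2).mul
    ((tendsto_inv_atTop_zero.comp (tendsto_threshold hr)).pow 2)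
  have hz : cornerWeight lam * (0 : ℝ) ^ 2 = 0 := by simp
  rw [hz] at hb
  refine squeeze_zero' (Eventually.of_forall fun m => meanScore_nonneg m r lam) ?_ hb
  filter_upwards [(tendsto_threshold hr).eventually_gt_atTop 0] with m hm
  simp only [Function.comp]
  have e : threshold m r ^ 2 * Real.exp (threshold m r ^ 2 / (1 + lam)) * meanScore m r lam
      * (threshold m r)⁻¹ ^ 2
      = Real.exp (threshold m r ^ 2 / (1 + lam)) * meanScore m r lam := by
    field_simp
  rw [e]
  have : 1 ≤ Real.exp (threshold m r ^ 2 / (1 + lam)) :=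
    Real.one_le_exp (div_nonneg (sq_nonneg _) (by linarith))
  nlinarith [meanScore_nonneg m r lam]

/-- The constant in `eps` cancels against the density at the corner and the standard deviation. -/
lemma cornerWeight_normalisation (h1 : -1 < lam) (h2 : lam < 1) (η : ℝ) :
    Real.sqrt (2 * Real.pi) * (1 + lam) * (1 - lam ^ 2) ^ (1 / 4 : ℝ) * η
      * (1 / (2 * Real.pi * Real.sqrt (1 - lam ^ 2))) / Real.sqrt (cornerWeight lam) = η := by
  have hp : 0 < 1 - lam ^ 2 := by nlinarith
  have hl : 0 < 1 + lam := by linarith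
  have hq : (1 - lam ^ 2) ^ (1 / 4 : ℝ) = Real.sqrt (Real.sqrt (1 - lam ^ 2)) := by
    rw [Real.sqrt_eq_rpow, Real.sqrt_eq_rpow, ← Real.rpow_mul hp.le]
    norm_num
  have hs : 0 < Real.sqrt (1 - lam ^ 2) := Real.sqrt_pos.2 hp
  rw [hq, cornerWeight, Real.sqrt_div (sq_nonneg _), Real.sqrt_sq hl.le,
    Real.sqrt_mul (by positivity) (Real.sqrt (1 - lam ^ 2))]
  have e1 := Real.mul_self_sqrt (show 0 ≤ 2 * Real.pi by positivity)
  have e2 := Real.mul_self_sqrt hs.le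
  have p1 : 0 < Real.sqrt (2 * Real.pi) := Real.sqrt_pos.2 (by positivity)
  have p2 : 0 < Real.sqrt (Real.sqrt (1 - lam ^ 2)) := Real.sqrt_pos.2 hs
  rw [div_div_eq_mul_div, div_eq_iff hl.ne']
  have : Real.sqrt (2 * Real.pi) * (1 + lam) * Real.sqrt (Real.sqrt (1 - lam ^ 2)) * η
      * (1 / (2 * Real.pi * Real.sqrt (1 - lam ^ 2)))
      * (Real.sqrt (2 * Real.pi) * Real.sqrt (Real.sqrt (1 - lam ^ 2)))
      = (Real.sqrt (2 * Real.pi) * Real.sqrt (2 * Real.pi))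
        * (Real.sqrt (Real.sqrt (1 - lam ^ 2)) * Real.sqrt (Real.sqrt (1 - lam ^ 2)))
        * (1 + lam) * η * (1 / (2 * Real.pi * Real.sqrt (1 - lam ^ 2))) := by ring
  rw [this, e1, e2]
  field_simp

/-- The probability that a document at correlation `lam - eps (η m)` is retrieved. The constants in
`eps` are exactly those for which the binomial mean is `η m` standard deviations away. -/
theorem tendsto_retrieval_tail (hr : 0 < r) (hlam : 2 * r - 1 < lam) (h1 : -1 < lam)
    (h2 : lam < 1) {η : ℕ → ℝ} {η₀ : ℝ} (hη : Tendsto η atTop (𝓝 η₀)) :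
    Tendsto (fun m : ℕ => binomialTail m (meanScore m r (lam - eps lam r m (η m)))
      (m * meanScore m r lam)) atTop (𝓝 (gaussianReal 0 1 (Set.Ici η₀))) := by
  have hl : 0 < 1 + lam := by linarith
  have ha : 0 < (lam - (2 * r - 1)) / (1 + lam) := div_pos (by linarith) hl
  set Y : ℕ → ℝ := fun m => (m : ℝ) ^ ((lam - (2 * r - 1)) / (1 + lam)) with hY
  set A : ℕ → ℝ := fun m => threshold m r ^ 2 * Real.exp (threshold m r ^ 2 / (1 + lam))
      * meanScore m r lam with hA
  have hAlim : Tendsto A atTop (𝓝 (cornerWeight lam)) :=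
    tendsto_sq_threshold_mul_meanScore hr h1 h2
  have hw := cornerWeight_pos h1 h2
  have hth := tendsto_threshold hr
  have hYpos : ∀ᶠ m in atTop, 0 < Y m := by
    filter_upwards [eventually_gt_atTop 0] with m hm
    exact Real.rpow_pos_of_pos (Nat.cast_pos.2 hm) _
  -- `m μ(lam) = A Y / h²`, where `Y` is a positive power of `m` and `A` converges.
  have hmp : ∀ᶠ m : ℕ in atTop, m * meanScore m r lam = A m * Y m / threshold m r ^ 2 := by
    filter_upwards [eventually_gt_atTop 0, hth.eventually_gt_atTop 0] with m hm hh
    have he : Real.exp (threshold m r ^ 2 / (1 + lam))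
        * Real.exp (-threshold m r ^ 2 / (1 + lam)) = 1 := by
      rw [← Real.exp_add, neg_div, add_neg_cancel, Real.exp_zero]
    simp only [hA, hY]
    rw [← mul_exp_neg_sq_threshold hr h1 hm, eq_div_iff (by positivity)]
    linear_combination (-(m : ℝ) * meanScore m r lam * threshold m r ^ 2) * he
  have hmean : Tendsto (fun m : ℕ => m * meanScore m r lam) atTop atTop := by
    have hsq : Tendsto (fun m => Real.sqrt (Y m)) atTop atTop :=
      Real.tendsto_sqrt_atTop.comp ((tendsto_rpow_atTop ha).comp tendsto_natCast_atTop_atTop)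
    have hrat : Tendsto (fun m => (threshold m r ^ 2 / Real.sqrt (Y m))⁻¹) atTop atTop := by
      refine Tendsto.inv_tendsto_nhdsGT_zero (tendsto_nhdsWithin_iff.2
        ⟨tendsto_threshold_pow_div_rpow hr ha, ?_⟩)
      filter_upwards [hYpos, hth.eventually_gt_atTop 0] with m hm hh
      exact div_pos (by positivity) (Real.sqrt_pos.2 hm)
    refine (hAlim.pos_mul_atTop hw (hrat.atTop_mul_atTop₀ hsq)).congr' ?_
    filter_upwards [hmp, hYpos] with m hm hYm
    rw [hm, inv_div, div_mul_eq_mul_div, Real.mul_self_sqrt hYm.le]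
    ring
  set s : ℕ → ℝ := fun m => Real.sqrt (m * meanScore m r lam) with hs
  have hslim : Tendsto s atTop atTop := Real.tendsto_sqrt_atTop.comp hmean
  -- The gap between the two binomial means, in standard deviations, tends to `η₀`.
  obtain ⟨ρ, hρ, hρeq⟩ := exists_orthantProb_increment h1 h2 (h := fun m => threshold m r)
    (tendsto_eps hr hlam hη) (tendsto_sq_threshold_mul_eps hr hlam hη)
  have hnear : Tendsto (fun m => lam - eps lam r m (η m)) atTop (𝓝 lam) := by
    simpa using (tendsto_eps hr hlam hη).const_sub lam
  have hgap : Tendsto (fun m : ℕ => (m * meanScore m r lam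
      - m * meanScore m r (lam - eps lam r m (η m))) / s m) atTop (𝓝 η₀) := by
    have hlim : Tendsto (fun m => Real.sqrt (2 * Real.pi) * (1 + lam)
        * (1 - lam ^ 2) ^ (1 / 4 : ℝ) * η m * ρ m / Real.sqrt (A m)) atTop (𝓝 η₀) := by
      have h := ((hη.const_mul (Real.sqrt (2 * Real.pi) * (1 + lam)
        * (1 - lam ^ 2) ^ (1 / 4 : ℝ))).mul hρ).div hAlim.sqrt (Real.sqrt_pos.2 hw).ne'
      rwa [cornerWeight_normalisation h1 h2] at h
    refine hlim.congr' ?_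
    filter_upwards [hmp, hYpos, hρeq, eventually_gt_atTop 0, hth.eventually_gt_atTop 0,
      hnear.eventually_const_lt h1, hnear.eventually_lt_const h2,
      hAlim.eventually_const_lt hw] with m hm hYm hρm hm0 hh hn1 hn2 hAm
    have hYs := Real.mul_self_sqrt hYm.le
    have hYs0 := Real.sqrt_pos.2 hYm
    have hAs0 := Real.sqrt_pos.2 hAm
    have hsm : s m = Real.sqrt (A m) * Real.sqrt (Y m) / threshold m r := by
      simp only [hs]
      rw [hm, Real.sqrt_div (by positivity), Real.sqrt_mul hAm.le, Real.sqrt_sq hh.le]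
    have hdiff : m * meanScore m r lam - m * meanScore m r (lam - eps lam r m (η m))
        = Y m * (eps lam r m (η m) * ρ m) := by
      rw [← hρm, meanScore_eq_orthantProb hh h1.le h2.le,
        meanScore_eq_orthantProb hh hn1.le hn2.le]
      simp only [hY]
      rw [← mul_exp_neg_sq_threshold hr h1 hm0]
      have he : Real.exp (-threshold m r ^ 2 / (1 + lam))
          * Real.exp (threshold m r ^ 2 / (1 + lam)) = 1 := by
        rw [← Real.exp_add, neg_div, neg_add_cancel, Real.exp_zero]
      linear_combination (-(m : ℝ) * (orthantProb (threshold m r) lam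
        - orthantProb (threshold m r) (lam - eps lam r m (η m)))) * he
    rw [hdiff, hsm, eps_eq hm0]
    change _ = Y m * (_ / (threshold m r * Real.sqrt (Y m)) * ρ m) / _
    rw [div_eq_div_iff hAs0.ne' (by positivity)]
    field_simp
    linear_combination ((1 - lam ^ 2) ^ (1 / 4 : ℝ) * η m * ρ m) * hYs
  -- Both success probabilities are asymptotically equal.
  have hratio : Tendsto (fun m : ℕ => m * meanScore m r (lam - eps lam r m (η m)) / s m ^ 2)
      atTop (𝓝 1) := by
    have h := (hgap.mul (tendsto_inv_atTop_zero.comp hslim)).const_sub 1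
    rw [mul_zero, sub_zero] at h
    refine h.congr' ?_
    filter_upwards [hslim.eventually_gt_atTop 0] with m hm
    have hsq : s m ^ 2 = m * meanScore m r lam :=
      Real.sq_sqrt (mul_nonneg (Nat.cast_nonneg m) (meanScore_nonneg m r lam))
    simp only [Function.comp]
    rw [← hsq]
    field_simp
    ring
  have hp : Tendsto (fun m => meanScore m r (lam - eps lam r m (η m))) atTop (𝓝 0) := by
    have h := hratio.mul (tendsto_meanScore_zero hr h1 h2)
    rw [mul_zero] at h
    refine h.congr' ?_
    filter_upwards [hmean.eventually_gt_atTop 0] with m hm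
    have hsq : s m ^ 2 = m * meanScore m r lam :=
      Real.sq_sqrt (mul_nonneg (Nat.cast_nonneg m) (meanScore_nonneg m r lam))
    rw [hsq, div_mul_eq_mul_div, div_eq_iff hm.ne']
    ring
  exact tendsto_binomialTail (fun m => meanScore_nonneg _ _ _) (fun m => meanScore_le_one _ _ _)
    hp hslim hratio hgap

end Scaling

/-! ### Error rates in terms of retrieval probabilities -/

/-- The probability that a document at inner product `t` with the query is retrieved; see
`measure_retrieved`. -/
noncomputable def retrievalProb (m : ℕ) (r lam t : ℝ) : ENNReal :=
  binomialTail m (meanScore m r t) (m * meanScore m r lam)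

lemma retrievalProb_mono {m : ℕ} {r lam s t : ℝ} (hh : 0 < threshold m r) (hs : -1 ≤ s)
    (hst : s ≤ t) (ht : t ≤ 1) : retrievalProb m r lam s ≤ retrievalProb m r lam t := by
  refine binomialTail_mono m ?_ _
  rw [meanScore_eq_orthantProb hh hs (hst.trans ht),
    meanScore_eq_orthantProb hh (hs.trans hst) ht]
  exact orthantProb_mono _ hst

section Errors

variable {Ω : Type*} [MeasurableSpace Ω] {P : Measure Ω} {d : ℕ} {a : ℕ → Ω → Vec d}

lemma aemeasurable_score (ha_law : ∀ i, HasLaw (a i) (stdGaussian (Vec d)) P) (m : ℕ) (r : ℝ)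
    (x y : Vec d) : AEMeasurable (fun ω => score m r (fun i => a i ω) x y) P := by
  simp only [score, bit_mul_bit]
  refine AEMeasurable.const_mul (Finset.aemeasurable_fun_sum _ fun i _ => ?_) _
  exact (measurable_const.indicator (measurableSet_pair _ x y)).comp_aemeasurable
    (ha_law i).aemeasurable

lemma nullMeasurableSet_retrieved (ha_law : ∀ i, HasLaw (a i) (stdGaussian (Vec d)) P) (m : ℕ)
    (r lam : ℝ) (x y : Vec d) :
    NullMeasurableSet {ω | Retrieved m r lam (fun i => a i ω) y x} P :=
  nullMeasurableSet_le aemeasurable_const (aemeasurable_score ha_law m r x y)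

lemma inner_mem_Icc (x y : UnitSphere d) :
    -1 ≤ inner ℝ (x : Vec d) y ∧ inner ℝ (x : Vec d) y ≤ 1 := by
  have h := abs_real_inner_le_norm (x : Vec d) (y : Vec d)
  rw [norm_eq_of_mem_sphere x, norm_eq_of_mem_sphere y, mul_one] at h
  exact abs_le.1 h

lemma lintegral_card_filter {X : Type*} (s : Finset X) (p : X → Prop) [DecidablePred p]
    (R : X → Ω → Prop) [∀ ω, DecidablePred fun x => p x ∧ R x ω]
    (hR : ∀ x, NullMeasurableSet {ω | R x ω} P) :
    ∫⁻ ω, ((s.filter fun x => p x ∧ R x ω).card : ENNReal) ∂P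
      = ∑ x ∈ s, if p x then P {ω | R x ω} else 0 := by
  have h : ∀ ω, ((s.filter fun x => p x ∧ R x ω).card : ENNReal)
      = ∑ x ∈ s, if p x then {ω | R x ω}.indicator (fun _ => (1 : ENNReal)) ω else 0 := by
    intro ω
    rw [Finset.card_filter, Nat.cast_sum]
    refine Finset.sum_congr rfl fun x _ => ?_
    by_cases h1 : p x <;> by_cases h2 : R x ω <;> simp [h1, h2]
  simp_rw [h]
  rw [lintegral_finsetSum']
  · refine Finset.sum_congr rfl fun x _ => ?_
    by_cases h1 : p x
    · simp only [h1, if_true]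
      rw [lintegral_indicator_const₀ (hR x), one_mul]
    · simp [h1]
  · intro x _
    by_cases h1 : p x
    · simp only [h1, if_true]
      exact aemeasurable_const.indicator₀ (hR x)
    · simp [h1]

variable [IsProbabilityMeasure P]

lemma measure_retrieved (ha_law : ∀ i, HasLaw (a i) (stdGaussian (Vec d)) P)
    (ha_indep : iIndepFun a P) {m : ℕ} (hm : 0 < m) (r lam : ℝ) {x y : Vec d} (hx : ‖x‖ = 1)
    (hy : ‖y‖ = 1) :
    P {ω | Retrieved m r lam (fun i => a i ω) y x} = retrievalProb m r lam (inner ℝ x y) := by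
  have hm' : (0 : ℝ) < m := Nat.cast_pos.2 hm
  have h := measure_le_sum_indicator P (stdGaussian (Vec d)) ha_law ha_indep
    (measurableSet_pair (threshold m r) x y) m (m * meanScore m r lam)
  rw [stdGaussian_real_eq_meanScore m r x y hx hy] at h
  rw [retrievalProb, ← h]
  congr 1
  ext ω
  simp only [Set.mem_ofPred_eq, Retrieved, score, bit_mul_bit]
  rw [one_div, inv_mul_eq_div, le_div_iff₀' hm']

open Classical in
/-- The counts `numTypeI` and `numTypeII` unfold to filters of this monadic expression, which is the
image of the corpus under the inclusion of the sphere, so that no document is lost or merged. -/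
lemma bind_pure_coe_eq_map (X : Finset (UnitSphere d)) :
    (X >>= fun x => pure (x : Vec d)) = X.map (Function.Embedding.subtype _) := by
  ext v
  simp [Finset.bind_def]

open Classical in
lemma sum_lintegral_errors (ha_law : ∀ i, HasLaw (a i) (stdGaussian (Vec d)) P)
    (ha_indep : iIndepFun a P) {m : ℕ} (hm : 0 < m) (r lam ε : ℝ) (y : UnitSphere d)
    (X : Finset (UnitSphere d)) :
    (∫⁻ ω, (numTypeI m r lam ε (fun i => a i ω) y X : ENNReal) ∂P)
      + (∫⁻ ω, (numTypeII m r lam ε (fun i => a i ω) y X : ENNReal) ∂P)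
      = ∑ x ∈ X, ((if EpsIrrelevant lam ε (y : Vec d) x then
          retrievalProb m r lam (inner ℝ (x : Vec d) y) else 0)
        + if EpsRelevant lam ε (y : Vec d) x then
          1 - retrievalProb m r lam (inner ℝ (x : Vec d) y) else 0) := by
  have hR := fun x : Vec d => nullMeasurableSet_retrieved ha_law m r lam x (y : Vec d)
  have hR' : ∀ x : Vec d,
      NullMeasurableSet {ω | ¬ Retrieved m r lam (fun i => a i ω) (y : Vec d) x} P :=
    fun x => (hR x).compl
  have hP : ∀ x : UnitSphere d, P {ω | Retrieved m r lam (fun i => a i ω) (y : Vec d) x}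
      = retrievalProb m r lam (inner ℝ (x : Vec d) y) := fun x =>
    measure_retrieved ha_law ha_indep hm r lam (norm_eq_of_mem_sphere x) (norm_eq_of_mem_sphere y)
  rw [Finset.sum_add_distrib]
  congr 1
  · unfold numTypeI
    rw [bind_pure_coe_eq_map, lintegral_card_filter _ (fun x => EpsIrrelevant lam ε (y : Vec d) x)
      (fun x ω => Retrieved m r lam (fun i => a i ω) (y : Vec d) x) hR, Finset.sum_map]
    refine Finset.sum_congr rfl fun x _ => ?_
    rw [← hP]
    rfl
  · unfold numTypeII
    rw [bind_pure_coe_eq_map, lintegral_card_filter _ (fun x => EpsRelevant lam ε (y : Vec d) x)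
      (fun x ω => ¬ Retrieved m r lam (fun i => a i ω) (y : Vec d) x) hR', Finset.sum_map]
    refine Finset.sum_congr rfl fun x _ => ?_
    rw [← hP, ← prob_compl_eq_one_sub₀ (hR x)]
    rfl

/-- Every document errs with probability at most that of a document exactly `ε` away from the
cut-off, on the corresponding side. -/
lemma worstErrorRate_le (ha_law : ∀ i, HasLaw (a i) (stdGaussian (Vec d)) P)
    (ha_indep : iIndepFun a P) {m n : ℕ} {r lam ε : ℝ} (hh : 0 < threshold m r)
    (hm : 0 < m) (hε : 0 < ε) (hl : -1 ≤ lam - ε) (hu : lam + ε ≤ 1)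
    (y : UnitSphere d) :
    worstErrorRate P a m n r lam ε y
      ≤ max (retrievalProb m r lam (lam - ε)) (1 - retrievalProb m r lam (lam + ε)) := by
  refine iSup_le fun X => ?_
  rw [sum_lintegral_errors ha_law ha_indep hm]
  refine ENNReal.div_le_of_le_mul ?_
  refine (Finset.sum_le_card_nsmul _ _
    (max (retrievalProb m r lam (lam - ε)) (1 - retrievalProb m r lam (lam + ε)))
    fun x _ => ?_).trans ?_
  · obtain ⟨h1, h2⟩ := inner_mem_Icc x y
    by_cases hi : EpsIrrelevant lam ε (y : Vec d) x
    · have hnr : ¬ EpsRelevant lam ε (y : Vec d) x := by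
        intro hr'
        unfold EpsIrrelevant at hi
        unfold EpsRelevant at hr'
        linarith
      rw [if_pos hi, if_neg hnr, add_zero]
      exact (retrievalProb_mono hh h1 hi (by linarith)).trans (le_max_left _ _)
    · rw [if_neg hi, zero_add]
      by_cases hr' : EpsRelevant lam ε (y : Vec d) x
      · rw [if_pos hr']
        exact (tsub_le_tsub_left (retrievalProb_mono hh (by linarith) hr' h2) 1).trans
          (le_max_right _ _)
      · rw [if_neg hr']
        exact zero_le
  · rw [X.2, nsmul_eq_mul, mul_comm]

/-- In dimension at least two every inner product in `[-1, 1]` with a unit vector is attained on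
the sphere. -/
lemma exists_inner_eq (hd : 2 ≤ d) (y : UnitSphere d) {t : ℝ} (h1 : -1 ≤ t) (h2 : t ≤ 1) :
    ∃ x : UnitSphere d, inner ℝ (x : Vec d) y = t := by
  have hrank : 1 < Module.rank ℝ (Vec d) := by
    rw [← Module.finrank_eq_rank, finrank_euclideanSpace_fin]
    exact_mod_cast hd
  have hyy : inner ℝ (y : Vec d) y = (1 : ℝ) := by
    rw [real_inner_self_eq_norm_sq, norm_eq_of_mem_sphere y, one_pow]
  have hivt := (isPreconnected_sphere hrank (0 : Vec d) 1).intermediate_value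
    (f := fun x => inner ℝ x (y : Vec d)) (-y).2 y.2
    (Continuous.continuousOn (by fun_prop))
  obtain ⟨x, hx, e⟩ := hivt (show t ∈ Set.Icc _ _ from
    ⟨by simpa [hyy] using h1, by simpa [hyy] using h2⟩)
  exact ⟨⟨x, hx⟩, e⟩

/-- A corpus of distinct documents just below the cut-off makes only type I errors. -/
lemma le_worstErrorRate (ha_law : ∀ i, HasLaw (a i) (stdGaussian (Vec d)) P)
    (ha_indep : iIndepFun a P) (hd : 2 ≤ d) {m n : ℕ} {r lam ε ε' : ℝ}
    (hh : 0 < threshold m r) (hm : 0 < m) (hn : 0 < n) (hε : ε < ε') (hl : -1 ≤ lam - ε')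
    (hu : lam - ε ≤ 1) (y : UnitSphere d) :
    retrievalProb m r lam (lam - ε') ≤ worstErrorRate P a m n r lam ε y := by
  have hn' : (0 : ℝ) < n := Nat.cast_pos.2 hn
  let t : Fin n → ℝ := fun j => lam - ε - (j : ℝ) / n * (ε' - ε)
  have hj0 : ∀ j : Fin n, 0 ≤ (j : ℝ) / n * (ε' - ε) := fun j =>
    mul_nonneg (by positivity) (by linarith)
  have hj1 : ∀ j : Fin n, (j : ℝ) / n * (ε' - ε) ≤ ε' - ε := fun j => by
    refine mul_le_of_le_one_left (by linarith) ?_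
    rw [div_le_one hn']
    exact_mod_cast j.2.le
  have ht1 : ∀ j, lam - ε' ≤ t j := fun j => by have := hj1 j; simp only [t]; linarith
  have ht2 : ∀ j, t j ≤ lam - ε := fun j => by have := hj0 j; simp only [t]; linarith
  choose x hx using fun j => exists_inner_eq hd y (hl.trans (ht1 j)) ((ht2 j).trans hu)
  have hinj : Function.Injective x := by
    intro j k hjk
    have h1 : t j = t k := by rw [← hx j, ← hx k, hjk]
    simp only [t, sub_right_inj] at h1
    have h2 := mul_right_cancel₀ (by linarith : ε' - ε ≠ 0) h1
    rw [div_left_inj' hn'.ne', Nat.cast_inj] at h2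
    exact Fin.ext h2
  let X : {X : Finset (UnitSphere d) // X.card = n} :=
    ⟨Finset.univ.map ⟨x, hinj⟩, by simp⟩
  refine le_trans ?_ (le_iSup _ X)
  rw [sum_lintegral_errors ha_law ha_indep hm, ENNReal.le_div_iff_mul_le
    (Or.inl (Nat.cast_ne_zero.2 hn.ne')) (Or.inl (ENNReal.natCast_ne_top n))]
  have hcard : retrievalProb m r lam (lam - ε') * n
      = X.1.card • retrievalProb m r lam (lam - ε') := by
    rw [X.2, nsmul_eq_mul, mul_comm]
  rw [hcard]
  refine Finset.card_nsmul_le_sum _ _ _ fun z hz => ?_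
  obtain ⟨j, -, rfl⟩ := Finset.mem_map.1 hz
  have hz' : EpsIrrelevant lam ε (y : Vec d) (x j) := by
    unfold EpsIrrelevant
    rw [hx j]
    exact ht2 j
  refine le_trans ?_ le_self_add
  simp only [Function.Embedding.coeFn_mk]
  rw [if_pos hz', hx j]
  exact retrievalProb_mono hh hl (ht1 j) ((ht2 j).trans hu)

end Errors

/-! ### The limit of the worst-case error rate -/

/-- Mills' upper bound for the standard normal tail. -/
lemma gaussianReal_Ici_le {η : ℝ} (hη : 0 < η) :
    gaussianReal 0 1 (Set.Ici η)
      ≤ ENNReal.ofReal (Real.exp (-η ^ 2 / 2) / (Real.sqrt (2 * Real.pi) * η)) := by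
  have hpi : 0 < Real.sqrt (2 * Real.pi) := Real.sqrt_pos.2 (by positivity)
  rw [gaussianReal_apply _ one_ne_zero]
  calc ∫⁻ x in Set.Ici η, gaussianPDF 0 1 x
      ≤ ∫⁻ x in Set.Ici η, ENNReal.ofReal (1 / (Real.sqrt (2 * Real.pi) * η))
          * ENNReal.ofReal (x * Real.exp (-x ^ 2 / 2)) := by
        refine setLIntegral_mono (by fun_prop) fun x hx => ?_
        rw [gaussianPDF, ← ENNReal.ofReal_mul (by positivity)]
        refine ENNReal.ofReal_le_ofReal ?_
        simp only [gaussianPDFReal, NNReal.coe_one, mul_one, sub_zero]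
        rw [div_mul_eq_mul_div, one_mul, le_div_iff₀ (by positivity)]
        have e : (Real.sqrt (2 * Real.pi))⁻¹ * Real.exp (-x ^ 2 / 2)
            * (Real.sqrt (2 * Real.pi) * η) = η * Real.exp (-x ^ 2 / 2) := by
          field_simp
        rw [e]
        exact mul_le_mul_of_nonneg_right hx (Real.exp_pos _).le
    _ = _ := by
        rw [lintegral_const_mul _ (by fun_prop), lintegral_Ici_mul_exp_neg_sq hη.le,
          ← ENNReal.ofReal_mul (by positivity)]
        congr 1
        ring

lemma one_sub_gaussianReal_Ici_neg (η : ℝ) :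
    1 - gaussianReal 0 1 (Set.Ici (-η)) = gaussianReal 0 1 (Set.Ici η) := by
  have := nullSingletonClass_gaussianReal (μ := 0) (v := 1) one_ne_zero
  rw [← prob_compl_eq_one_sub measurableSet_Ici, Set.compl_Ici, measure_congr Iio_ae_eq_Iic]
  have h := gaussianReal_map_neg (μ := 0) (v := 1)
  rw [neg_zero] at h
  nth_rewrite 1 [← h]
  rw [Measure.map_apply measurable_neg measurableSet_Iic]
  congr 1
  ext x
  simp

lemma eps_lt_eps {lam r : ℝ} {m : ℕ} {η η' : ℝ} (hm : 0 < m) (hh : 0 < threshold m r)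
    (h1 : -1 < lam) (h2 : lam < 1) (hη : η < η') : eps lam r m η < eps lam r m η' := by
  have hm' : (0 : ℝ) < m := Nat.cast_pos.2 hm
  have hl : 0 < 1 + lam := by linarith
  have hp : 0 < (1 - lam ^ 2) ^ (1 / 4 : ℝ) := Real.rpow_pos_of_pos (by nlinarith) _
  have hY : 0 < Real.sqrt ((m : ℝ) ^ ((lam - (2 * r - 1)) / (1 + lam))) :=
    Real.sqrt_pos.2 (Real.rpow_pos_of_pos hm' _)
  rw [eps_eq hm, eps_eq hm]
  gcongr

lemma eps_neg (lam r : ℝ) (m : ℕ) (η : ℝ) : eps lam r m (-η) = -eps lam r m η := by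
  unfold eps epsConst
  ring

lemma eps_zero (lam r : ℝ) (m : ℕ) : eps lam r m 0 = 0 := by simp [eps, epsConst]

/-- The limit of the worst-case error rate. -/
theorem tendsto_worstErrorRate {Ω : Type*} [MeasurableSpace Ω] {P : Measure Ω}
    [IsProbabilityMeasure P] {d : ℕ} (hd : 2 ≤ d) {a : ℕ → Ω → Vec d}
    (ha_law : ∀ i, HasLaw (a i) (stdGaussian (Vec d)) P) (ha_indep : iIndepFun a P)
    (y : UnitSphere d) {r lam : ℝ} (hr : 0 < r) (hlam : 2 * r - 1 < lam) (h2 : lam < 1)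
    {η : ℝ} (hη : 0 < η) {n : ℕ} (hn : 0 < n) :
    Tendsto (fun m : ℕ => worstErrorRate P a m n r lam (eps lam r m η) y) atTop
      (𝓝 (gaussianReal 0 1 (Set.Ici η))) := by
  have h1 : -1 < lam := by linarith
  have hth := tendsto_threshold hr
  -- Slightly more than `eps η`, to make room for `n` distinct inner products; this is needed when
  -- `d = 2`, where only two points of the circle have a given inner product with `y`.
  have hη' : Tendsto (fun m : ℕ => η + 1 / ((m : ℝ) + 1)) atTop (𝓝 η) := by
    simpa using tendsto_one_div_add_atTop_nhds_zero_nat.const_add η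
  have hε := tendsto_eps hr hlam (tendsto_const_nhds (x := η))
  have hε' := tendsto_eps hr hlam hη'
  have hlow := tendsto_retrieval_tail hr hlam h1 h2 hη'
  have hI := tendsto_retrieval_tail hr hlam h1 h2 (tendsto_const_nhds (x := η))
  have hII := tendsto_retrieval_tail hr hlam h1 h2 (tendsto_const_nhds (x := -η))
  have hII' := ENNReal.Tendsto.sub (tendsto_const_nhds (x := (1 : ENNReal))) hII
    (Or.inl ENNReal.one_ne_top)
  rw [one_sub_gaussianReal_Ici_neg] at hII'
  have hup := hI.max hII'
  rw [max_self] at hup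
  have hpos : ∀ᶠ m : ℕ in atTop, 0 < m ∧ 0 < threshold m r :=
    (eventually_gt_atTop 0).and (hth.eventually_gt_atTop 0)
  refine tendsto_of_tendsto_of_tendsto_of_le_of_le' hlow hup ?_ ?_
  · filter_upwards [hpos, hε'.eventually_lt_const (show (0 : ℝ) < lam + 1 by linarith)]
      with m hm hm'
    have hlt : eps lam r m η < eps lam r m (η + 1 / ((m : ℝ) + 1)) :=
      eps_lt_eps hm.1 hm.2 h1 h2 (by have : (0 : ℝ) < 1 / ((m : ℝ) + 1) := by positivity
                                     linarith)
    have hε0 := eps_lt_eps hm.1 hm.2 h1 h2 hη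
    rw [eps_zero] at hε0
    exact le_worstErrorRate ha_law ha_indep hd hm.2 hm.1 hn hlt (by linarith) (by linarith) y
  · filter_upwards [hpos, hε.eventually_lt_const (show (0 : ℝ) < lam + 1 by linarith),
      hε.eventually_lt_const (show (0 : ℝ) < 1 - lam by linarith)] with m hm hm1 hm2
    have hε0 := eps_lt_eps hm.1 hm.2 h1 h2 hη
    rw [eps_zero] at hε0
    have h := worstErrorRate_le (n := n) (lam := lam) ha_law ha_indep hm.2 hm.1 hε0 (by linarith)
      (by linarith) y
    rw [eps_neg, sub_neg_eq_add]
    exact h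

end SparseMap

theorem theorem1 {Ω : Type*} [MeasurableSpace Ω] (P : Measure Ω) [IsProbabilityMeasure P]
    (d : ℕ) (hd : 2 ≤ d)
    (a : ℕ → Ω → SparseMap.Vec d)
    (ha_law : ∀ i, HasLaw (a i) (stdGaussian (SparseMap.Vec d)) P)
    (ha_indep : iIndepFun a P)
    (y : SparseMap.UnitSphere d)
    (r lam : ℝ) (hr : 0 < r) (hlam_gt : 2 * r - 1 < lam) (hlam_lt : lam < 1) (hlam_pos : 0 < lam) :
    (∀ (η : ℝ), 0 < η → ∀ (n : ℕ), 1 ≤ n →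
      Tendsto
        (fun m : ℕ => SparseMap.worstErrorRate P a m n r lam (SparseMap.eps lam r m η) y)
        atTop (𝓝 (gaussianReal 0 1 (Set.Ici η)))) ∧
    (∀ (n : ℕ), 2 ≤ n →
      ∃ L : ENNReal,
        Tendsto
          (fun m : ℕ => SparseMap.worstErrorRate P a m n r lam
            (SparseMap.eps lam r m (2 * Real.sqrt (Real.log n))) y)
          atTop (𝓝 L) ∧
        L ≤ ENNReal.ofReal (1 / ((n : ℝ) ^ 2 * Real.sqrt (8 * Real.pi * Real.log n)))) := by
  refine ⟨fun η hη n hn => SparseMap.tendsto_worstErrorRate hd ha_law ha_indep y hr hlam_gt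
    hlam_lt hη hn, fun n hn => ?_⟩
  have hn0 : (0 : ℝ) < n := Nat.cast_pos.2 (by omega)
  have hlog : 0 < Real.log n := Real.log_pos (by exact_mod_cast (by omega : 1 < n))
  have hη : 0 < 2 * Real.sqrt (Real.log n) := by positivity
  refine ⟨_, SparseMap.tendsto_worstErrorRate hd ha_law ha_indep y hr hlam_gt hlam_lt hη
    (by omega), (SparseMap.gaussianReal_Ici_le hη).trans (le_of_eq ?_)⟩
  congr 1
  have hexp : Real.exp (-(2 * Real.sqrt (Real.log n)) ^ 2 / 2) = ((n : ℝ) ^ 2)⁻¹ := by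
    rw [mul_pow, Real.sq_sqrt hlog.le]
    have : -(2 ^ 2 * Real.log n) / 2 = -(Real.log n + Real.log n) := by ring
    rw [this, Real.exp_neg, Real.exp_add, Real.exp_log hn0, sq]
  have hsqrt : Real.sqrt (8 * Real.pi * Real.log n)
      = Real.sqrt (2 * Real.pi) * (2 * Real.sqrt (Real.log n)) := by
    have : 8 * Real.pi * Real.log n = 2 * Real.pi * (2 ^ 2 * Real.log n) := by ring
    rw [this, Real.sqrt_mul (by positivity), Real.sqrt_mul (x := 2 ^ 2) (by positivity),
      Real.sqrt_sq (by norm_num)]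
  rw [hexp, hsqrt, one_div, mul_inv, div_eq_mul_inv]
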